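/- Let $G=(V,E)$ be a finite graph with maximum degree $\Delta$ (with $\log 0$ read as $0$ if $\Delta=0$) and let $0<\varepsilon<1$. In the beeping model with simultaneous wake-up, in each slot every node either beeps or listens; a listening node only learns whether at least one of its neighbours beeps in this slot. Consider the following randomized algorithm. Let $I$ be $2000(\ln 1500+\ln(2/\varepsilon))$, rounded up to an even integer, and let $R=\lceil 104000\,(\log_2\Delta+\log_2(2/\varepsilon))\rceil$. The algorithm consists of $R$ rounds of $2I+1$ slots each. Initially all nodes are active, and every node $v$ has desire-level $p_0(v)=1/2$. In round $t$ the active nodes act as follows; all random choices are independent, and nodes that are not active stay silent. 1. First interval ($I$ slots): in each slot, $v$ beeps with probability $p_t(v)$ and listens otherwise. Let $c_t(v)$ be the number of slots in which $v$ listens and $b_t(v)$ the number of those in which it receives a beep. If $c_t(v)>I/3$, then $v$ is called high if and only if $b_t(v)/c_t(v)>1/5$; if $c_t(v)\le I/3$, then $v$ is called high with probability $1/2$. If $v$ is high, then $p_{t+1}(v)=p_t(v)/2$, otherwise $p_{t+1}(v)=\min\{2p_t(v),1/2\}$. 2. Second interval ($I$ slots): $v$ gets marked with probability $p_t(v)$.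 A marked node beeps in a uniformly random set of $I/2$ slots of the interval and listens in the others, and unmarked nodes listen. A marked node that receives no beep joins the set $M$. 3. Final slot: the nodes that joined $M$ in this round beep and terminate with output IN. The other active nodes that receive a beep in this slot terminate with output OUT. The output of a node is never revised. The output of a node $v$ is called locally correct if either it is IN, no neighbour of $v$ is IN at that moment, and no neighbour of $v$ outputs IN later; or it is OUT and some neighbour of $v$ is IN at that moment. **Theorem.** The total number $R(2I+1)$ of slots is $O\big((\log\Delta+\log(2/\varepsilon))\cdot\log(2/\varepsilon)\big)$, and hence $O\big((\log\Delta+\log(1/\varepsilon))\cdot\log(1/\varepsilon)\big)$ for $\varepsilon\le 1/2$, with absolute constants. For every node $v$, with probability at least $1-\varepsilon$, $v$ terminates within these $R(2I+1)$ slots with a locally correct output. This holds even if the coin tosses of an arbitrary set of nodes at hop-distance more than $2$ from $v$ are determined by an adversary, who may choose the outcomes for a round knowing all random coin tosses of that round and of all earlier rounds, but not those of later rounds. -/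

import Mathlib

universe u

noncomputable section

namespace BeepMIS

/-! ### Parameters of the algorithm -/

/-- Half the length of an interval: `⌈1000 (ln 1500 + ln (2/ε))⌉`. -/
def halfLen (ε : ℝ) : ℕ := ⌈1000 * (Real.log 1500 + Real.log (2 / ε))⌉₊

/-- The length `I` of an interval: `2000 (ln 1500 + ln (2/ε))`, rounded up to an even integer
(half of the slots of an interval get selected later). -/
def intervalLen (ε : ℝ) : ℕ := 2 * halfLen ε

/-- The number `R` of emulated rounds: `γ (log₂ Δ + log₂ (2/ε))` with `γ = 104000`, rounded up.
(`Real.logb 2 0 = 0`, so an edgeless graph is treated like `Δ = 1`.) -/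
def rounds (Δ : ℕ) (ε : ℝ) : ℕ := ⌈104000 * (Real.logb 2 Δ + Real.logb 2 (2 / ε))⌉₊

/-- The number of slots of an emulated round: two intervals and one final slot. -/
def slotsPerRound (I : ℕ) : ℕ := 2 * I + 1

/-! ### Coin tosses -/

/-- The sets consisting of half of the slots of an interval. -/
abbrev HalfSet (I : ℕ) : Type := {S : Finset (Fin I) // 2 * S.card = I}

/-- A block of `R` fair coin tosses. A desire-level is always `2⁻ᵏ` with `1 ≤ k ≤ R`, and a
decision that has to be taken with probability `2⁻ᵏ` is taken iff the first `k` tosses of a fresh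
block all come up heads, see `heads`. -/
abbrev Block (R : ℕ) : Type := Fin R → Bool

/-- All coin tosses of one node in one emulated round: a block for each slot of the first interval,
one fair coin, a block for getting marked, and a half set of slots for the second interval. -/
abbrev Toss (R I : ℕ) : Type := (Fin I → Block R) × Bool × Block R × HalfSet I

/-- The block that decides whether the node beeps in a slot of the first interval. -/
def Toss.beep {R I : ℕ} (τ : Toss R I) : Fin I → Block R := τ.1

/-- The fair coin replacing the estimate of a node that has listened too rarely. -/
def Toss.guess {R I : ℕ} (τ : Toss R I) : Bool := τ.2.1

/-- The block that decides whether the node gets marked. -/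
def Toss.mark {R I : ℕ} (τ : Toss R I) : Block R := τ.2.2.1

/-- The slots of the second interval in which the node beeps if it is marked. -/
def Toss.slots {R I : ℕ} (τ : Toss R I) : Finset (Fin I) := τ.2.2.2.1

/-- The first `k` tosses of the block come up heads. -/
def heads {R : ℕ} (β : Block R) (k : ℕ) : Prop := ∀ j : Fin R, j.val < k → β j = true

/-- Probability in a finite space with uniform distribution. -/
def Pr {Ω : Type*} (E : Set Ω) : ℝ := (E.ncard : ℝ) / (Nat.card Ω : ℝ)

/-- The coin tosses of all nodes in all rounds; under the uniform distribution on this finite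
product they are independent, and each of them is uniform. -/
abbrev Tosses (V : Type*) (R I : ℕ) : Type _ := Fin R → V → Toss R I

/-! ### The algorithm -/

/-- Undecided, or terminated with output IN, or terminated with output OUT. -/
inductive Status : Type
  | active
  | isIn
  | isOut

/-- The state of a node between two emulated rounds: its status and the number `k` for which its
desire-level is `2⁻ᵏ`. -/
structure NodeState : Type where
  status : Status
  level : ℕ

/-- The desire-level `p_t(v)`. -/
def NodeState.desire (x : NodeState) : ℝ := (1 / 2 : ℝ) ^ x.level

/-- At the start every node is active and has desire-level `1/2`. -/
def initial : NodeState := ⟨Status.active, 1⟩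

variable {V : Type*}

/-- The beep channel: if `B` is the set of nodes that beep in a slot, then `v` receives a beep in
this slot iff it does not beep itself and at least one of its neighbours beeps. -/
def hears (G : SimpleGraph V) (B : V → Prop) (v : V) : Prop := ¬ B v ∧ ∃ u, G.Adj v u ∧ B u

section Round

variable (G : SimpleGraph V) {R I : ℕ} (x : V → NodeState) (τ : V → Toss R I)

/-- First interval, slot `i`: an active node beeps with probability its desire-level. -/
def beepsFirst (i : Fin I) (u : V) : Prop :=
  (x u).status = Status.active ∧ heads ((τ u).beep i) (x u).level

/-- The counter `c_t(v)`: the number of slots of the first interval in which `v` listens. -/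
def listenCount (v : V) : ℕ := {i : Fin I | ¬ beepsFirst x τ i v}.ncard

/-- The counter `b_t(v)`: the number of slots of the first interval in which `v` receives a beep. -/
def beepCount (v : V) : ℕ := {i : Fin I | hears G (beepsFirst x τ i) v}.ncard

/-- `v` assumes `b_t(v)/c_t(v) > 1/5`: if `c_t(v) > I/3` this is what it has measured, otherwise
it is decided by a fair coin. -/
def LikelyHigh (v : V) : Prop :=
  ((I : ℝ) / 3 < listenCount x τ v ∧ (1 / 5 : ℝ) < (beepCount G x τ v : ℝ) / listenCount x τ v) ∨
    ((listenCount x τ v : ℝ) ≤ (I : ℝ) / 3 ∧ (τ v).guess = true)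

/-- At the beginning of the second interval an active node gets marked with probability its
desire-level (the one that was valid during the first interval). -/
def Marked (u : V) : Prop := (x u).status = Status.active ∧ heads (τ u).mark (x u).level

/-- Second interval, slot `i`: the marked nodes that have selected this slot beep. -/
def beepsSecond (i : Fin I) (u : V) : Prop := Marked x τ u ∧ i ∈ (τ u).slots

/-- A marked node that receives no beep in the second interval joins `M`. In the final slot of the
round exactly the nodes that have joined `M` in this round beep. -/
def Joins (v : V) : Prop := Marked x τ v ∧ ∀ i : Fin I, ¬ hears G (beepsSecond x τ i) v

open Classical in
/-- The new states after a round. In the final slot the active nodes that beep terminate with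
output IN, and those that receive a beep terminate with output OUT. The desire-level of a remaining
node is halved, or else doubled but not beyond `1/2`. -/
def step (v : V) : NodeState :=
  if (x v).status = Status.active then
    if Joins G x τ v then ⟨Status.isIn, (x v).level⟩
    else if hears G (Joins G x τ) v then ⟨Status.isOut, (x v).level⟩
    else if LikelyHigh G x τ v then ⟨Status.active, (x v).level + 1⟩
    else ⟨Status.active, max ((x v).level - 1) 1⟩
  else x v

end Round

/-- The states after `t` rounds; the algorithm stops after `R` rounds. -/
def run (G : SimpleGraph V) {R I : ℕ} (ω : Tosses V R I) : ℕ → V → NodeState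
  | 0 => fun _ => initial
  | t + 1 => if h : t < R then step G (run G ω t) (ω ⟨t, h⟩) else run G ω t

/-- The status of `v` after the first `s` slots. It can only change in the final slot of a round. -/
def statusAt (G : SimpleGraph V) {R I : ℕ} (ω : Tosses V R I) (s : ℕ) (v : V) : Status :=
  (run G ω (s / slotsPerRound I) v).status

/-- In slot `s` the node `v` terminates with an irrevocable and locally correct output: either IN,
and none of its neighbours is IN at this moment or outputs IN later; or OUT, and some neighbour is
IN at this moment. -/
def TerminatesCorrectlyAt (G : SimpleGraph V) {R I : ℕ} (ω : Tosses V R I) (v : V) (s : ℕ) : Prop :=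
  (∀ s' < s, statusAt G ω s' v = Status.active) ∧
  (∀ s' ≥ s, statusAt G ω s' v = statusAt G ω s v) ∧
  ((statusAt G ω s v = Status.isIn ∧
      ∀ u, G.Adj v u → ∀ s' ≥ s, statusAt G ω s' u ≠ Status.isIn) ∨
    (statusAt G ω s v = Status.isOut ∧ ∃ u, G.Adj v u ∧ statusAt G ω s u = Status.isIn))

/-! ### Adversarial coin tosses -/

/-- A strategy of an adversary proposes outcomes of coin tosses. It may depend on all random coin
tosses of the earlier rounds and of the current round, but not on those of later rounds. -/
def NonAnticipating {R I : ℕ} (adv : Tosses V R I → Tosses V R I) : Prop :=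
  ∀ (ω ω' : Tosses V R I) (t : Fin R), (∀ s ≤ t, ω s = ω' s) → adv ω t = adv ω' t

open Classical in
/-- The tosses with which the algorithm is run: those of the nodes in `A` are determined by the
adversary, those of the other nodes are random. (The unused random tosses of the nodes in `A` can
serve the adversary as private randomness.) -/
def corrupt {R I : ℕ} (A : Set V) (adv : Tosses V R I → Tosses V R I) (ω : Tosses V R I) :
    Tosses V R I :=
  fun t u => if u ∈ A then adv ω t u else ω t u

/-! ### The blocks realise the desire-levels exactly -/

/-- Every desire-level used in round `t < R` is `2⁻ᵏ` with `1 ≤ k ≤ t + 1 ≤ R`. -/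
theorem level_run (G : SimpleGraph V) {R I : ℕ} (ω : Tosses V R I) (t : ℕ) (v : V) :
    1 ≤ (run G ω t v).level ∧ (run G ω t v).level ≤ t + 1 := by
  induction t generalizing v with
  | zero => simp [run, initial]
  | succ t ih =>
    have := ih v
    unfold run
    split_ifs with h
    · unfold step
      split_ifs <;> (try dsimp only) <;> omega
    · omega

/-- A decision taken with a block of `R` tosses succeeds with probability the desire-level. -/
theorem pr_heads {R : ℕ} (x : NodeState) (hk : x.level ≤ R) :
    Pr {β : Block R | heads β x.level} = x.desire := by
  classical
  have h1 : {β : Block R | heads β x.level} =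
      (Fintype.piFinset fun j : Fin R =>
        if j.val < x.level then ({true} : Finset Bool) else Finset.univ : Finset (Block R)) := by
    ext β
    simp only [heads, Set.mem_ofPred_eq, Finset.mem_coe, Fintype.mem_piFinset]
    refine forall_congr' fun j => ?_
    split_ifs with h <;> simp [h]
  have h2 : ∀ j : Fin R, (if j.val < x.level then ({true} : Finset Bool) else Finset.univ).card =
      if j.val < x.level then 1 else 2 := by
    intro j
    split_ifs <;> simp
  have h3 : ∏ j : Fin R, (if j.val < x.level then 1 else 2) = 2 ^ (R - x.level) := by
    rw [Fin.prod_univ_eq_prod_range (fun j => if j < x.level then 1 else 2) R,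
      ← Finset.prod_range_mul_prod_Ico _ hk,
      Finset.prod_congr rfl (fun j hj => if_pos (Finset.mem_range.1 hj)),
      Finset.prod_congr rfl (fun j hj => if_neg (not_lt.2 (Finset.mem_Ico.1 hj).1))]
    simp
  unfold Pr NodeState.desire
  rw [h1, Set.ncard_coe_finset, Fintype.card_piFinset, Finset.prod_congr rfl (fun j _ => h2 j), h3]
  simp only [Nat.card_eq_fintype_card, Fintype.card_pi, Fintype.card_bool, Finset.prod_const,
    Finset.card_univ, Fintype.card_fin, Nat.cast_pow, Nat.cast_ofNat]
  rw [pow_sub₀ _ (by norm_num) hk, div_pow, one_pow]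
  field_simp

end BeepMIS

end

/-!
An output can only be incorrect if a node `v` joins simultaneously with a neighbour, so there are two
failures to bound: that `v` is still active after all rounds, and such a clash. Both are governed
by potential functions of the state of `v` and its neighbours. The tosses of a round are resampled
with the history fixed (`expect_round_le`); the events of a round that matter for `v` depend only on
the tosses within distance `2`, so the adversary has no influence on them (`FixesNear`).

*The estimates.* By an exponential moment bound over the independent slots of the first interval, a
node of effective degree at least `1/2` is called high, and one of effective degree at most `1/8`
is not, each with error probability at most `1/1000`.

*Termination.* Let `k` be the level of `v` and `d` its effective degree, and let `D` be the part of
`d` that comes from neighbours of effective degree below `1/2`. If `D ≥ 1/100`, then with constant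
probability one of these neighbours gets marked while none of its own neighbours does
(`le_pr_exists_isolated`), and then `v` is removed. If `D < 1/100`, then `d` drops in expectation
to about `d/2 + 3D/2`, and the energy `(6/5)^k (d + 2/25)` contracts in expectation: for `d > 1/8` the
decrease of `d` outweighs a possible increase of `k`; for `d ≤ 1/8` the level decreases, or is already
`1` and `v` joins with constant probability. The power `1/1000` of the energy grows so little in the
first case that the chance of removal compensates for it, hence this power contracts in every round
(`expect_rpow_energy_step_le`). Initially it is polynomial in the maximum degree, and it is bounded
below while `v` is active, so Markov's inequality applies (`pr_active_le`).

*Clashes.* A clash in a given round requires that `v` gets marked and selects exactly the slots of a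
marked neighbour, which has probability at most `p_t(v) / binom(I, I/2)`. A union bound over the rounds
would cost a factor `log Δ` that is not available, as `I` does not depend on `Δ`. But the expected sum of
the desire-levels `p_t(v)` over the rounds in which `v` is active is bounded by a constant: for small
`d` the node `v` joins with probability proportional to `p_t(v)`, and for large `d` its desire-level is
likely to be halved (`expect_budget_step_le`).
-/

noncomputable section

namespace BeepMIS

open Finset
open scoped BigOperators Classical

/-! ### Averages over finite uniform spaces -/

section Average

variable {Ω Ω' : Type*} [Fintype Ω] [Fintype Ω']

theorem pr_eq_expect (P : Ω → Prop) [DecidablePred P] :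
    Pr {ω | P ω} = 𝔼 ω, if P ω then (1 : ℝ) else 0 := by
  rw [Fintype.expect_eq_sum_div_card, Finset.sum_boole, Pr, Nat.card_eq_fintype_card,
    ← Set.ncard_coe_finset]
  simp

theorem pr_nonneg {Ω : Type*} (E : Set Ω) : 0 ≤ Pr E := by
  unfold Pr; positivity

theorem pr_mono {P Q : Ω → Prop} (h : ∀ ω, P ω → Q ω) : Pr {ω | P ω} ≤ Pr {ω | Q ω} := by
  rw [pr_eq_expect, pr_eq_expect]
  refine expect_le_expect fun ω _ => ?_
  have := h ω
  split_ifs <;> first | tauto | norm_num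

theorem pr_or_le (P Q : Ω → Prop) :
    Pr {ω | P ω ∨ Q ω} ≤ Pr {ω | P ω} + Pr {ω | Q ω} := by
  rw [pr_eq_expect, pr_eq_expect, pr_eq_expect, ← expect_add_distrib]
  refine expect_le_expect fun ω _ => ?_
  split_ifs <;> first | tauto | norm_num

theorem pr_or_of_disjoint {P Q : Ω → Prop} (h : ∀ ω, P ω → ¬ Q ω) :
    Pr {ω | P ω ∨ Q ω} = Pr {ω | P ω} + Pr {ω | Q ω} := by
  rw [pr_eq_expect, pr_eq_expect, pr_eq_expect, ← expect_add_distrib]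
  refine expect_congr rfl fun ω _ => ?_
  have := h ω
  split_ifs <;> first | tauto | norm_num

theorem pr_not [Nonempty Ω] (P : Ω → Prop) : Pr {ω | ¬ P ω} = 1 - Pr {ω | P ω} := by
  rw [pr_eq_expect, pr_eq_expect, eq_sub_iff_add_eq, ← expect_add_distrib,
    ← Fintype.expect_one (ι := Ω) (M := ℝ)]
  refine expect_congr rfl fun ω _ => ?_
  split_ifs <;> norm_num

theorem pr_le_one [Nonempty Ω] (P : Ω → Prop) : Pr {ω | P ω} ≤ 1 := by
  have := pr_not P
  have := pr_nonneg {ω | ¬ P ω}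
  linarith

/-- The finite union bound. -/
theorem pr_exists_le {ι : Type*} (s : Finset ι) (P : ι → Ω → Prop) :
    Pr {ω | ∃ i ∈ s, P i ω} ≤ ∑ i ∈ s, Pr {ω | P i ω} := by
  induction s using Finset.induction_on with
  | empty => simp [Pr]
  | insert a s ha ih =>
    rw [sum_insert ha]
    have : ∀ ω, (∃ i ∈ insert a s, P i ω) ↔ (P a ω ∨ ∃ i ∈ s, P i ω) := by
      intro ω; simp
    simp only [this]
    linarith [pr_or_le (P a) (fun ω => ∃ i ∈ s, P i ω)]

theorem expect_fst [Nonempty Ω'] (g : Ω → ℝ) : 𝔼 z : Ω × Ω', g z.1 = 𝔼 a, g a := by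
  rw [← univ_product_univ, expect_product]
  simp

theorem expect_snd [Nonempty Ω] (g : Ω' → ℝ) : 𝔼 z : Ω × Ω', g z.2 = 𝔼 b, g b := by
  rw [← univ_product_univ, expect_product]
  simp

theorem pr_fst [Nonempty Ω'] (P : Ω → Prop) : Pr {z : Ω × Ω' | P z.1} = Pr {a | P a} := by
  rw [pr_eq_expect, pr_eq_expect]
  exact expect_fst fun a => if P a then (1 : ℝ) else 0

theorem pr_snd [Nonempty Ω] (P : Ω' → Prop) : Pr {z : Ω × Ω' | P z.2} = Pr {b | P b} := by
  rw [pr_eq_expect, pr_eq_expect]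
  exact expect_snd fun b => if P b then (1 : ℝ) else 0

theorem one_sub_sum_le_prod {ι : Type*} (S : Finset ι) (p : ι → ℝ) (h0 : ∀ w ∈ S, 0 ≤ p w)
    (h1 : ∀ w ∈ S, p w ≤ 1) : 1 - ∑ w ∈ S, p w ≤ ∏ w ∈ S, (1 - p w) := by
  induction S using Finset.induction_on with
  | empty => simp
  | insert a s ha ih =>
    rw [sum_insert ha, prod_insert ha]
    have h := ih (fun w hw => h0 w (mem_insert_of_mem hw))
      (fun w hw => h1 w (mem_insert_of_mem hw))
    have ha0 := h0 a (mem_insert_self _ _)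
    have ha1 := h1 a (mem_insert_self _ _)
    have hs : 0 ≤ ∑ w ∈ s, p w := sum_nonneg fun w hw => h0 w (mem_insert_of_mem hw)
    nlinarith

theorem prod_one_sub_le {ι : Type*} (S : Finset ι) (p : ι → ℝ) (h0 : ∀ w ∈ S, 0 ≤ p w)
    (h1 : ∀ w ∈ S, p w ≤ 1) : ∏ w ∈ S, (1 - p w) ≤ 1 / (1 + ∑ w ∈ S, p w) := by
  have hs : 0 ≤ ∑ w ∈ S, p w := sum_nonneg h0
  calc ∏ w ∈ S, (1 - p w) ≤ ∏ w ∈ S, Real.exp (-p w) :=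
        prod_le_prod (fun w hw => by linarith [h1 w hw])
          (fun w _ => by linarith [Real.add_one_le_exp (-p w)])
    _ = 1 / Real.exp (∑ w ∈ S, p w) := by
        rw [← Real.exp_sum, sum_neg_distrib, Real.exp_neg, one_div]
    _ ≤ 1 / (1 + ∑ w ∈ S, p w) := by
        refine one_div_le_one_div_of_le (by linarith) ?_
        linarith [Real.add_one_le_exp (∑ w ∈ S, p w)]

variable {ι α : Type*} [Fintype ι] [DecidableEq ι] [Fintype α]

/-- Resampling one coordinate does not change the uniform distribution. -/
theorem expect_update [Nonempty α] (t : ι) (g : (ι → α) → ℝ) :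
    𝔼 ω, g ω = 𝔼 ω, 𝔼 a, g (Function.update ω t a) := by
  -- exchanging the coordinate with the fresh sample is an involution of the product space
  let e : (ι → α) × α ≃ (ι → α) × α :=
    { toFun := fun z => (Function.update z.1 t z.2, z.1 t)
      invFun := fun z => (Function.update z.1 t z.2, z.1 t)
      left_inv := fun z => by simp
      right_inv := fun z => by simp }
  rw [← expect_fst (Ω' := α) g, ← expect_product' univ univ
    (fun ω a => g (Function.update ω t a)), univ_product_univ]
  exact (Fintype.expect_equiv e _ _ fun z => rfl).symm

/-- Independence of the coordinates. -/
theorem expect_prod (f : ι → α → ℝ) : 𝔼 σ : ι → α, ∏ i, f i (σ i) = ∏ i, 𝔼 a, f i a := by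
  simp only [Fintype.expect_eq_sum_div_card, prod_div_distrib, prod_univ_sum, Fintype.card_fun,
    Fintype.piFinset_univ, prod_const, card_univ, Nat.cast_pow]

/-! ### Independent events attached to the vertices of a graph -/

variable [Nonempty α] (Q : ι → α → Prop)

theorem pr_forall_not (S : Finset ι) :
    Pr {σ : ι → α | ∀ w ∈ S, ¬ Q w (σ w)} = ∏ w ∈ S, (1 - Pr {a | Q w a}) := by
  have h : ∀ σ : ι → α, (if ∀ w ∈ S, ¬ Q w (σ w) then (1 : ℝ) else 0) =
      ∏ w, if w ∈ S then (if ¬ Q w (σ w) then (1 : ℝ) else 0) else 1 := by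
    intro σ
    rw [Fintype.prod_ite_mem, Finset.prod_boole]
    congr
  rw [pr_eq_expect, expect_congr rfl fun σ _ => h σ,
    expect_prod (fun w a => if w ∈ S then (if ¬ Q w a then (1 : ℝ) else 0) else 1),
    ← Fintype.prod_ite_mem S]
  refine prod_congr rfl fun w _ => ?_
  split_ifs
  · rw [← pr_not, pr_eq_expect]
  · simp

theorem pr_and_forall_not {u : ι} {S : Finset ι} (hu : u ∉ S) :
    Pr {σ : ι → α | Q u (σ u) ∧ ∀ w ∈ S, ¬ Q w (σ w)} =
      Pr {a | Q u a} * ∏ w ∈ S, (1 - Pr {a | Q w a}) := by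
  have h1 := pr_forall_not Q (insert u S)
  have h2 := pr_forall_not Q S
  rw [prod_insert hu] at h1
  have h3 : Pr {σ : ι → α | ∀ w ∈ S, ¬ Q w (σ w)} =
      Pr {σ : ι → α | Q u (σ u) ∧ ∀ w ∈ S, ¬ Q w (σ w)} +
        Pr {σ : ι → α | ∀ w ∈ insert u S, ¬ Q w (σ w)} := by
    rw [← pr_or_of_disjoint]
    · congr 1
      ext σ
      simp only [Set.mem_ofPred_eq, mem_insert, forall_eq_or_imp]
      tauto
    · simp only [mem_insert, forall_eq_or_imp]
      tauto
  linarith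

/-- If each `u ∈ S` sees no event in `N u` with probability at least `c`, then with probability at
least `c` times that of an event in `S`, some event in `S` occurs that sees none. The first event of
`S` in a fixed order is a candidate, and the absence of earlier events only helps. -/
theorem le_pr_exists_isolated (N : ι → Finset ι) (hN : ∀ u, u ∉ N u) (c : ℝ) (S : Finset ι)
    (hS : ∀ u ∈ S, c ≤ ∏ w ∈ N u, (1 - Pr {a | Q w a})) :
    c * (1 - ∏ u ∈ S, (1 - Pr {a | Q u a})) ≤
      Pr {σ : ι → α | ∃ u ∈ S, Q u (σ u) ∧ ∀ w ∈ N u, ¬ Q w (σ w)} := by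
  induction S using Finset.induction_on with
  | empty => simpa using pr_nonneg _
  | insert a s ha ih =>
    have ih' := ih fun u hu => hS u (mem_insert_of_mem hu)
    have hq0 : ∀ w, 0 ≤ 1 - Pr {a | Q w a} := fun w => by linarith [pr_le_one (Q w)]
    have hq1 : ∀ w, 1 - Pr {a | Q w a} ≤ 1 := fun w => by linarith [pr_nonneg {a | Q w a}]
    have hnew := pr_and_forall_not Q (u := a) (S := N a ∪ s) (by simp [hN, ha])
    have hdisj : Pr {σ : ι → α | ∃ u ∈ s, Q u (σ u) ∧ ∀ w ∈ N u, ¬ Q w (σ w)} +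
        Pr {σ : ι → α | Q a (σ a) ∧ ∀ w ∈ N a ∪ s, ¬ Q w (σ w)} ≤
        Pr {σ : ι → α | ∃ u ∈ insert a s, Q u (σ u) ∧ ∀ w ∈ N u, ¬ Q w (σ w)} := by
      rw [← pr_or_of_disjoint]
      · refine pr_mono fun σ h => ?_
        rcases h with ⟨u, hu, h⟩ | ⟨h1, h2⟩
        · exact ⟨u, mem_insert_of_mem hu, h⟩
        · exact ⟨a, mem_insert_self _ _, h1, fun w hw => h2 w (mem_union_left _ hw)⟩
      · rintro σ ⟨u, hu, h, -⟩ ⟨-, h2⟩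
        exact h2 u (mem_union_right _ hu) h
    have hprod : c * ∏ u ∈ s, (1 - Pr {a | Q u a}) ≤ ∏ w ∈ N a ∪ s, (1 - Pr {a | Q w a}) := by
      have h1 : (∏ w ∈ N a, (1 - Pr {a | Q w a})) * ∏ u ∈ s, (1 - Pr {a | Q u a}) ≤
          ∏ w ∈ N a ∪ s, (1 - Pr {a | Q w a}) := by
        rw [← prod_union_inter]
        exact mul_le_of_le_one_right (prod_nonneg fun w _ => hq0 w)
          (prod_le_one (fun w _ => hq0 w) fun w _ => hq1 w)
      refine le_trans ?_ h1
      exact mul_le_mul_of_nonneg_right (hS a (mem_insert_self _ _))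
        (prod_nonneg fun w _ => hq0 w)
    have h4 := mul_le_mul_of_nonneg_left hprod (pr_nonneg {b | Q a b})
    rw [← hnew] at h4
    rw [prod_insert ha]
    nlinarith
end Average

/-! ### The coin tosses of one round -/

/-- The desire-level of an active node, and `0` for a node that has terminated: the probability
with which the node beeps in a slot of the first interval, or gets marked. -/
def weight {V : Type*} (x : V → NodeState) (u : V) : ℝ :=
  if (x u).status = Status.active then (x u).desire else 0

/-- The effective degree `d_t(w)`: the sum of the desire-levels of the active neighbours. -/
def effDeg {V : Type*} [Fintype V] (G : SimpleGraph V) [DecidableRel G.Adj] (x : V → NodeState)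
    (w : V) : ℝ := ∑ u ∈ G.neighborFinset w, weight x u

section Coins

variable {V : Type*} {R I : ℕ}

theorem weight_nonneg (x : V → NodeState) (u : V) : 0 ≤ weight x u := by
  unfold weight NodeState.desire
  split_ifs <;> positivity

theorem weight_le_half (x : V → NodeState) (hx : ∀ u, 1 ≤ (x u).level) (u : V) :
    weight x u ≤ 1 / 2 := by
  unfold weight NodeState.desire
  split_ifs
  · simpa using pow_le_pow_of_le_one (by norm_num : (0 : ℝ) ≤ 1 / 2) (by norm_num) (hx u)
  · norm_num

theorem pr_and_prod {Ω Ω' : Type*} [Fintype Ω] [Fintype Ω'] (P : Ω → Prop) (Q : Ω' → Prop) :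
    Pr {z : Ω × Ω' | P z.1 ∧ Q z.2} = Pr {a | P a} * Pr {b | Q b} := by
  rw [pr_eq_expect, pr_eq_expect, pr_eq_expect, Fintype.expect_mul_expect]
  rw [← univ_product_univ, expect_product]
  refine expect_congr rfl fun a _ => expect_congr rfl fun b _ => ?_
  by_cases P a <;> by_cases Q b <;> simp_all

theorem pr_active_and_heads (x : V → NodeState) (hR : ∀ u, (x u).level ≤ R) (u : V) :
    Pr {β : Block R | (x u).status = Status.active ∧ heads β (x u).level} = weight x u := by
  unfold weight
  split_ifs with h
  · rw [← pr_heads (x u) (hR u)]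
    simp [h]
  · simp [h, Pr]

theorem pr_active_and_mark [Nonempty (HalfSet I)] (x : V → NodeState)
    (hR : ∀ u, (x u).level ≤ R) (u : V) :
    Pr {τ : Toss R I | (x u).status = Status.active ∧ heads τ.mark (x u).level} = weight x u := by
  rw [← pr_active_and_heads x hR u]
  unfold Toss.mark
  rw [pr_snd (fun z : Bool × Block R × HalfSet I =>
      (x u).status = Status.active ∧ heads z.2.1 (x u).level),
    pr_snd (fun z : Block R × HalfSet I =>
      (x u).status = Status.active ∧ heads z.1 (x u).level),
    pr_fst (fun z : Block R => (x u).status = Status.active ∧ heads z (x u).level)]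

theorem pr_mark_and_slots_eq_le [Nonempty (HalfSet I)] (x : V → NodeState)
    (hR : ∀ u, (x u).level ≤ R) (u : V) (S : Finset (Fin I)) :
    Pr {τ : Toss R I | ((x u).status = Status.active ∧ heads τ.mark (x u).level) ∧ τ.slots = S} ≤
      weight x u / Nat.card (HalfSet I) := by
  unfold Toss.mark Toss.slots
  rw [pr_snd (fun z : Bool × Block R × HalfSet I =>
      ((x u).status = Status.active ∧ heads z.2.1 (x u).level) ∧ z.2.2.1 = S),
    pr_snd (fun z : Block R × HalfSet I =>
      ((x u).status = Status.active ∧ heads z.1 (x u).level) ∧ z.2.1 = S),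
    pr_and_prod (fun z : Block R => (x u).status = Status.active ∧ heads z (x u).level)
      (fun z : HalfSet I => z.1 = S), pr_active_and_heads x hR u, div_eq_mul_one_div]
  refine mul_le_mul_of_nonneg_left ?_ (weight_nonneg x u)
  unfold Pr
  refine div_le_div_of_nonneg_right ?_ (by positivity)
  have : {z : HalfSet I | z.1 = S}.Subsingleton := fun a ha b hb =>
    Subtype.ext (ha.trans hb.symm)
  exact_mod_cast Set.ncard_le_one_iff_subsingleton.2 this

 /-- A score for a single slot of the first interval, as a function of the blocks of all nodes:
`a` if `u` beeps, `b` if `u` receives a beep, `c` if `u` listens in vain. -/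
def slotScore (G : SimpleGraph V) (x : V → NodeState) (u : V) (a b c : ℝ) (β : V → Block R) : ℝ :=
  let B : V → Prop := fun w => (x w).status = Status.active ∧ heads (β w) (x w).level
  if B u then a else if hears G B u then b else c

theorem prod_slotScore (G : SimpleGraph V) (x : V → NodeState) (u : V) (a b c : ℝ)
    (τ : V → Toss R I) :
    ∃ m n : ℕ, m + listenCount x τ u = I ∧ beepCount G x τ u + n = listenCount x τ u ∧
      ∏ i, slotScore G x u a b c (fun w => (τ w).beep i) = a ^ m * b ^ beepCount G x τ u * c ^ n := by
  have hl : listenCount x τ u = #{i : Fin I | ¬ beepsFirst x τ i u} := by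
    rw [listenCount, ← Set.ncard_coe_finset]; simp
  have hb : beepCount G x τ u = #{i : Fin I | hears G (beepsFirst x τ i) u} := by
    rw [beepCount, ← Set.ncard_coe_finset]; simp
  refine ⟨#{i : Fin I | beepsFirst x τ i u},
    #{i : Fin I | ¬ beepsFirst x τ i u ∧ ¬ hears G (beepsFirst x τ i) u}, ?_, ?_, ?_⟩
  · rw [hl, card_filter_add_card_filter_not, card_univ, Fintype.card_fin]
  · have : univ.filter (fun i : Fin I => hears G (beepsFirst x τ i) u) =
        univ.filter fun i => ¬ beepsFirst x τ i u ∧ hears G (beepsFirst x τ i) u := by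
      ext i
      simp only [mem_filter, mem_univ, true_and]
      exact ⟨fun h => ⟨h.1, h⟩, fun h => h.2⟩
    rw [hl, hb, this, ← filter_filter, ← filter_filter, card_filter_add_card_filter_not]
  · rw [hb, ← prod_const, ← prod_const, ← prod_const, prod_filter, prod_filter, prod_filter,
      ← prod_mul_distrib, ← prod_mul_distrib]
    refine prod_congr rfl fun i _ => ?_
    by_cases h1 : beepsFirst x τ i u
    · have h2 : ¬ hears G (beepsFirst x τ i) u := fun h => h.1 h1
      refine (if_pos h1).trans ?_
      simp [h1, h2]
    · by_cases h2 : hears G (beepsFirst x τ i) u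
      · refine ((if_neg h1).trans (if_pos h2)).trans ?_
        simp [h1, h2]
      · refine ((if_neg h1).trans (if_neg h2)).trans ?_
        simp [h1, h2]

variable [Fintype V] [DecidableEq V]

/-- The slots of the first interval are independent and identically distributed. -/
theorem expect_slots [Nonempty (HalfSet I)] (F : (V → Block R) → ℝ) :
    𝔼 τ : V → Toss R I, ∏ i, F (fun u => (τ u).beep i) = (𝔼 β, F β) ^ I := by
  let C := Bool × Block R × HalfSet I
  have h1 : 𝔼 τ : V → Toss R I, ∏ i, F (fun u => (τ u).beep i) =
      𝔼 z : (V → Fin I → Block R) × (V → C), ∏ i, F (fun u => z.1 u i) :=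
    Fintype.expect_equiv (Equiv.arrowProdEquivProdArrow V (fun _ => Fin I → Block R) fun _ => C) _ _
      fun τ => rfl
  have h2 : 𝔼 z : V → Fin I → Block R, ∏ i, F (fun u => z u i) =
      𝔼 z : Fin I → V → Block R, ∏ i, F (z i) :=
    Fintype.expect_equiv (Equiv.piComm fun _ _ => Block R) _ _ fun z => rfl
  rw [h1, expect_fst (Ω' := V → C) fun z : V → Fin I → Block R => ∏ i, F (fun u => z u i), h2,
    expect_prod fun _ => F]
  simp

variable (G : SimpleGraph V) [DecidableRel G.Adj] (x : V → NodeState)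

theorem expect_slotScore (hR : ∀ u, (x u).level ≤ R) (u : V) (a b c : ℝ) :
    𝔼 β, slotScore (R := R) G x u a b c β = a * weight x u + (1 - weight x u) *
      (b * (1 - ∏ w ∈ G.neighborFinset u, (1 - weight x w)) +
        c * ∏ w ∈ G.neighborFinset u, (1 - weight x w)) := by
  let Q : V → Block R → Prop := fun w β => (x w).status = Status.active ∧ heads β (x w).level
  have hQ : ∀ w, Pr {β | Q w β} = weight x w := pr_active_and_heads x hR
  have h1 := pr_forall_not Q {u}
  have h2 := pr_forall_not Q (insert u (G.neighborFinset u))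
  rw [prod_insert (by simp)] at h2
  simp only [hQ, prod_singleton] at h1 h2
  have key : 𝔼 β, slotScore (R := R) G x u a b c β =
      a + (b - a) * Pr {β : V → Block R | ∀ w ∈ ({u} : Finset V), ¬ Q w (β w)} +
      (c - b) * Pr {β : V → Block R | ∀ w ∈ insert u (G.neighborFinset u), ¬ Q w (β w)} := by
    rw [pr_eq_expect, pr_eq_expect, mul_expect, mul_expect,
      ← Fintype.expect_const (ι := V → Block R) a, ← expect_add_distrib, ← expect_add_distrib]
    refine expect_congr rfl fun β _ => ?_
    rw [Fintype.expect_const]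
    have e1 : (∀ w ∈ ({u} : Finset V), ¬ Q w (β w)) ↔ ¬ Q u (β u) := by simp
    have e2 : (∀ w ∈ insert u (G.neighborFinset u), ¬ Q w (β w)) ↔
        ¬ Q u (β u) ∧ ¬ ∃ w, G.Adj u w ∧ Q w (β w) := by
      simp
    simp only [e1, e2]
    by_cases k1 : Q u (β u)
    · refine (if_pos k1).trans ?_
      simp [k1]
    · by_cases k2 : ∃ w, G.Adj u w ∧ Q w (β w)
      · refine ((if_neg k1).trans (if_pos ⟨k1, k2⟩)).trans ?_
        simp only [k1, k2, not_true_eq_false, not_false_eq_true, and_false, if_true, if_false]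
        ring
      · refine ((if_neg k1).trans (if_neg fun h => k2 h.2)).trans ?_
        simp only [k1, k2, not_false_eq_true, and_true, if_true]
        ring
  rw [key, h1, h2]
  ring

omit [DecidableRel G.Adj] in
/-- Exponential moment bound for the counters of the first interval: the product of the slot scores
dominates the indicator of the event `P`. Below, the scores are powers of a base near `1` whose exponents
add up to a nonnegative number on `P`. -/
theorem pr_le_pow_expect_slotScore [Nonempty (HalfSet I)] (u : V) {a b c r : ℝ} (ha : 0 ≤ a)
    (hb : 0 ≤ b) (hc : 0 ≤ c) (hr : 𝔼 β, slotScore (R := R) G x u a b c β ≤ r)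
    (P : (V → Toss R I) → Prop)
    (hP : ∀ τ, P τ → ∀ m n : ℕ, m + listenCount x τ u = I →
      beepCount G x τ u + n = listenCount x τ u → 1 ≤ a ^ m * b ^ beepCount G x τ u * c ^ n) :
    Pr {τ | P τ} ≤ r ^ I := by
  have h0 : ∀ β, 0 ≤ slotScore (R := R) G x u a b c β := by
    intro β
    simp only [slotScore]
    split_ifs <;> assumption
  calc Pr {τ | P τ}
      ≤ 𝔼 τ : V → Toss R I, ∏ i, slotScore G x u a b c (fun w => (τ w).beep i) := by
        rw [pr_eq_expect]
        refine expect_le_expect fun τ _ => ?_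
        split_ifs with h
        · obtain ⟨m, n, h1, h2, h3⟩ := prod_slotScore G x u a b c τ
          rw [h3]
          exact hP τ h m n h1 h2
        · exact prod_nonneg fun i _ => h0 _
    _ = (𝔼 β, slotScore (R := R) G x u a b c β) ^ I := expect_slots _
    _ ≤ r ^ I := pow_le_pow_left₀ (expect_nonneg fun β _ => h0 β) hr I

end Coins

/-! ### The estimates of the first interval -/

section Estimate

theorem two_mul_pow_le {I : ℕ} (hI : 14000 ≤ I) : (99 / 100 : ℝ) ^ I + (99 / 100) ^ I ≤ 1 / 1000 := by
  have : (99 / 100 : ℝ) ^ I ≤ (99 / 100) ^ (80 * 10) :=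
    pow_le_pow_of_le_one (by norm_num) (by norm_num) (by omega)
  rw [pow_mul] at this
  have h2 : ((99 / 100 : ℝ) ^ 80) ^ 10 ≤ (9 / 20) ^ 10 :=
    pow_le_pow_left₀ (by norm_num) (by norm_num) 10
  have h3 : (9 / 20 : ℝ) ^ 10 ≤ 1 / 2000 := by norm_num
  linarith

variable {V : Type*} {R I : ℕ} [Fintype V] [DecidableEq V] (G : SimpleGraph V) [DecidableRel G.Adj]
  (x : V → NodeState) [Nonempty (HalfSet I)]

/-- A node listens with probability at least `1/2` in each slot, so hardly ever in fewer than a third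
of the slots. -/
theorem pr_listenCount_le (hx : ∀ u, 1 ≤ (x u).level) (hR : ∀ u, (x u).level ≤ R)
    (u : V) :
    Pr {τ : V → Toss R I | 3 * listenCount x τ u ≤ I} ≤ (99 / 100) ^ I := by
  have hw := weight_le_half x hx u
  -- only listening matters, so the graph may be replaced by the empty one
  refine pr_le_pow_expect_slotScore ⊥ x u (a := 5 / 4) (b := (4 / 5) ^ 2) (c := (4 / 5) ^ 2)
    (by norm_num) (by norm_num) (by norm_num) ?_ _ ?_
  · rw [expect_slotScore ⊥ x hR]
    nlinarith
  · intro τ h m n h1 h2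
    rw [mul_assoc, ← pow_add, h2, ← pow_mul]
    calc (1 : ℝ) = (5 / 4) ^ (2 * listenCount x τ u) * (4 / 5) ^ (2 * listenCount x τ u) := by
          rw [← mul_pow]; norm_num
      _ ≤ _ := by
          refine mul_le_mul_of_nonneg_right (pow_le_pow_right₀ (by norm_num) ?_) (by positivity)
          omega

/-- A node of effective degree at least `1/2` receives a beep with probability at least `1/3` when it
listens, so hardly ever in at most a fifth of the slots in which it listens. -/
theorem pr_beepCount_le (hx : ∀ u, 1 ≤ (x u).level) (hR : ∀ u, (x u).level ≤ R) (u : V)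
    (hd : 1 / 2 ≤ effDeg G x u) :
    Pr {τ : V → Toss R I | 5 * beepCount G x τ u ≤ listenCount x τ u} ≤ (99 / 100) ^ I := by
  have hw := weight_le_half x hx u
  have hπ : ∏ w ∈ G.neighborFinset u, (1 - weight x w) ≤ 2 / 3 := by
    refine (prod_one_sub_le _ _ (fun w _ => weight_nonneg x w)
      fun w _ => (weight_le_half x hx w).trans (by norm_num)).trans ?_
    change 1 / (1 + effDeg G x u) ≤ 2 / 3
    rw [div_le_div_iff₀ (by linarith) (by norm_num)]
    linarith
  refine pr_le_pow_expect_slotScore G x u (a := 1) (b := (4 / 5) ^ 4) (c := 5 / 4)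
    (by norm_num) (by norm_num) (by norm_num) ?_ _ ?_
  · rw [expect_slotScore G x hR]
    nlinarith
  · intro τ h m n h1 h2
    rw [one_pow, one_mul, ← pow_mul]
    calc (1 : ℝ) = (4 / 5) ^ (4 * beepCount G x τ u) * (5 / 4) ^ (4 * beepCount G x τ u) := by
          rw [← mul_pow]; norm_num
      _ ≤ _ := by
          refine mul_le_mul_of_nonneg_left (pow_le_pow_right₀ (by norm_num) ?_) (by positivity)
          omega

/-- A node of effective degree at most `1/8` receives a beep with probability at most `1/8` when it
listens. -/
theorem pr_le_beepCount_le (hx : ∀ u, 1 ≤ (x u).level) (hR : ∀ u, (x u).level ≤ R) (u : V)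
    (hd : effDeg G x u ≤ 1 / 8) :
    Pr {τ : V → Toss R I | listenCount x τ u ≤ 5 * beepCount G x τ u} ≤ (99 / 100) ^ I := by
  have hw := weight_le_half x hx u
  have hπ : 7 / 8 ≤ ∏ w ∈ G.neighborFinset u, (1 - weight x w) := by
    refine le_trans ?_ (one_sub_sum_le_prod _ _ (fun w _ => weight_nonneg x w)
      fun w _ => (weight_le_half x hx w).trans (by norm_num))
    change _ ≤ 1 - effDeg G x u
    linarith
  refine pr_le_pow_expect_slotScore G x u (a := 1) (b := (11 / 10) ^ 4) (c := 10 / 11)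
    (by norm_num) (by norm_num) (by norm_num) ?_ _ ?_
  · rw [expect_slotScore G x hR]
    nlinarith
  · intro τ h m n h1 h2
    rw [one_pow, one_mul, ← pow_mul]
    calc (1 : ℝ) = (11 / 10) ^ n * (10 / 11) ^ n := by
          rw [← mul_pow]; norm_num
      _ ≤ _ := by
          refine mul_le_mul_of_nonneg_right (pow_le_pow_right₀ (by norm_num) ?_) (by positivity)
          omega

/-- A node with a large effective degree is likely to be called high. -/
theorem pr_not_likelyHigh_le (hI : 14000 ≤ I) (hx : ∀ u, 1 ≤ (x u).level)
    (hR : ∀ u, (x u).level ≤ R) (u : V) (hd : 1 / 2 ≤ effDeg G x u) :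
    Pr {τ : V → Toss R I | ¬ LikelyHigh G x τ u} ≤ 1 / 1000 := by
  refine le_trans ?_ (two_mul_pow_le hI)
  refine le_trans ?_ (add_le_add (pr_listenCount_le x hx hR u) (pr_beepCount_le G x hx hR u hd))
  refine le_trans (pr_mono fun τ h => ?_) (pr_or_le _ _)
  by_contra hc
  push Not at hc
  refine h (Or.inl ⟨?_, ?_⟩)
  · have : (I : ℝ) < 3 * listenCount x τ u := by exact_mod_cast hc.1
    linarith
  · have h1 : (listenCount x τ u : ℝ) < 5 * beepCount G x τ u := by exact_mod_cast hc.2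
    have h2 : (0 : ℝ) < listenCount x τ u := by
      have := hc.1
      exact_mod_cast (by omega : 0 < listenCount x τ u)
    rw [lt_div_iff₀ h2]
    linarith

/-- A node with a small effective degree is unlikely to be called high. -/
theorem pr_likelyHigh_le (hI : 14000 ≤ I) (hx : ∀ u, 1 ≤ (x u).level)
    (hR : ∀ u, (x u).level ≤ R) (u : V) (hd : effDeg G x u ≤ 1 / 8) :
    Pr {τ : V → Toss R I | LikelyHigh G x τ u} ≤ 1 / 1000 := by
  refine le_trans ?_ (two_mul_pow_le hI)
  refine le_trans ?_ (add_le_add (pr_listenCount_le x hx hR u)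
    (pr_le_beepCount_le G x hx hR u hd))
  refine le_trans (pr_mono fun τ h => ?_) (pr_or_le _ _)
  rcases h with ⟨h1, h2⟩ | ⟨h1, -⟩
  · right
    have h3 : (0 : ℝ) < listenCount x τ u := lt_of_le_of_lt (by positivity) h1
    rw [lt_div_iff₀ h3] at h2
    have : (listenCount x τ u : ℝ) ≤ 5 * beepCount G x τ u := by linarith
    exact_mod_cast this
  · left
    have : 3 * (listenCount x τ u : ℝ) ≤ I := by linarith
    exact_mod_cast this

end Estimate

/-! ### Locality -/

section Local

variable {V : Type*} {R I : ℕ} (G : SimpleGraph V) (x : V → NodeState) {τ τ' : V → Toss R I}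

theorem hears_congr {B B' : V → Prop} {v : V} (hv : B v ↔ B' v)
    (hn : ∀ w, G.Adj v w → (B w ↔ B' w)) : hears G B v ↔ hears G B' v := by
  unfold hears
  rw [hv]
  refine and_congr_right fun _ => exists_congr fun w => ?_
  exact and_congr_right fun hw => hn w hw

theorem likelyHigh_congr {v : V} (hv : τ v = τ' v) (hn : ∀ w, G.Adj v w → τ w = τ' w) :
    LikelyHigh G x τ v ↔ LikelyHigh G x τ' v := by
  have h : ∀ {w}, τ w = τ' w → ∀ i, (beepsFirst x τ i w ↔ beepsFirst x τ' i w) := by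
    intro w hw i
    unfold beepsFirst
    rw [hw]
  have h1 : listenCount x τ v = listenCount x τ' v := by
    unfold listenCount
    simp only [h hv]
  have h2 : beepCount G x τ v = beepCount G x τ' v := by
    unfold beepCount
    simp only [hears_congr G (h hv _) fun w hw => h (hn w hw) _]
  unfold LikelyHigh
  rw [h1, h2, hv]

theorem joins_congr {v : V} (hv : τ v = τ' v) (hn : ∀ w, G.Adj v w → τ w = τ' w) :
    Joins G x τ v ↔ Joins G x τ' v := by
  have h : ∀ {w}, τ w = τ' w → (Marked x τ w ↔ Marked x τ' w) := by
    intro w hw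
    unfold Marked
    rw [hw]
  have h' : ∀ {w}, τ w = τ' w → ∀ i, (beepsSecond x τ i w ↔ beepsSecond x τ' i w) := by
    intro w hw i
    unfold beepsSecond
    rw [h hw, hw]
  unfold Joins
  rw [h hv]
  refine and_congr_right fun _ => forall_congr' fun i => not_congr ?_
  exact hears_congr G (h' hv i) fun w hw => h' (hn w hw) i

/-- The transformation `T` of the coin tosses of a round leaves those of the nodes at distance at
most `2` from `v` unchanged. -/
def FixesNear (v : V) (T : (V → Toss R I) → V → Toss R I) : Prop :=
  ∀ τ u, G.edist v u ≤ 2 → T τ u = τ u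

variable {G} {v : V} {T : (V → Toss R I) → V → Toss R I}

theorem FixesNear.self (hT : FixesNear G v T) (τ : V → Toss R I) : T τ v = τ v :=
  hT τ v (by simp)

theorem FixesNear.adj (hT : FixesNear G v T) (τ : V → Toss R I) {u : V} (hu : G.Adj v u) :
    T τ u = τ u :=
  hT τ u (by rw [SimpleGraph.edist_eq_one_iff_adj.2 hu]; norm_num)

theorem FixesNear.adj_adj (hT : FixesNear G v T) (τ : V → Toss R I) {u w : V} (hu : G.Adj v u)
    (hw : G.Adj u w) : T τ w = τ w :=
  hT τ w ((SimpleGraph.Walk.cons hu (SimpleGraph.Walk.cons hw .nil)).edist_le.trans (by simp))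

theorem FixesNear.likelyHigh_iff (hT : FixesNear G v T) (τ : V → Toss R I) :
    LikelyHigh G x (T τ) v ↔ LikelyHigh G x τ v :=
  likelyHigh_congr G x (hT.self τ) fun _ hw => hT.adj τ hw

theorem FixesNear.likelyHigh_adj_iff (hT : FixesNear G v T) (τ : V → Toss R I) {u : V}
    (hu : G.Adj v u) : LikelyHigh G x (T τ) u ↔ LikelyHigh G x τ u :=
  likelyHigh_congr G x (hT.adj τ hu) fun _ hw => hT.adj_adj τ hu hw

theorem FixesNear.joins_iff (hT : FixesNear G v T) (τ : V → Toss R I) :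
    Joins G x (T τ) v ↔ Joins G x τ v :=
  joins_congr G x (hT.self τ) fun _ hw => hT.adj τ hw

theorem FixesNear.joins_adj_iff (hT : FixesNear G v T) (τ : V → Toss R I) {u : V}
    (hu : G.Adj v u) : Joins G x (T τ) u ↔ Joins G x τ u :=
  joins_congr G x (hT.adj τ hu) fun _ hw => hT.adj_adj τ hu hw

theorem FixesNear.step_eq (hT : FixesNear G v T) (τ : V → Toss R I) :
    step G x (T τ) v = step G x τ v := by
  have h := hears_congr G (hT.joins_iff x τ) fun u hu => hT.joins_adj_iff x τ hu
  unfold step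
  simp only [hT.joins_iff x τ, h, hT.likelyHigh_iff x τ]

end Local

/-! ### The effect of one round -/

section Step

variable {V : Type*} {R I : ℕ} (G : SimpleGraph V) (x : V → NodeState)

theorem step_of_not_active (τ : V → Toss R I) {v : V} (h : (x v).status ≠ Status.active) :
    step G x τ v = x v := by
  unfold step; rw [if_neg h]

theorem active_of_step_active {τ : V → Toss R I} {v : V}
    (h : (step G x τ v).status = Status.active) : (x v).status = Status.active := by
  by_contra hc
  rw [step_of_not_active G x τ hc] at h
  exact hc h

theorem step_of_joins {τ : V → Toss R I} {v : V} (h : Joins G x τ v) :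
    (step G x τ v).status = Status.isIn := by
  unfold step; rw [if_pos h.1.1, if_pos h]

theorem step_of_adj_joins {τ : V → Toss R I} {v u : V} (ha : (x v).status = Status.active)
    (hv : ¬ Joins G x τ v) (huv : G.Adj v u) (hu : Joins G x τ u) :
    (step G x τ v).status = Status.isOut := by
  unfold step; rw [if_pos ha, if_neg hv, if_pos ⟨hv, u, huv, hu⟩]

theorem joins_of_isolated {τ : V → Toss R I} {v : V} (h : Marked x τ v)
    (hn : ∀ w, G.Adj v w → ¬ Marked x τ w) : Joins G x τ v :=
  ⟨h, fun _ hi => by obtain ⟨-, w, hw, hm, -⟩ := hi; exact hn w hw hm⟩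

theorem level_of_step_active {τ : V → Toss R I} {v : V}
    (h : (step G x τ v).status = Status.active) :
    (step G x τ v).level = if LikelyHigh G x τ v then (x v).level + 1 else max ((x v).level - 1) 1 := by
  have ha := active_of_step_active G x h
  unfold step at h ⊢
  rw [if_pos ha] at h ⊢
  split_ifs at h ⊢ <;> rfl

theorem weight_step_le_two_mul (hx : ∀ u, 1 ≤ (x u).level) (τ : V → Toss R I) (u : V) :
    weight (step G x τ) u ≤ 2 * weight x u := by
  have h0 := weight_nonneg x u
  by_cases h : (step G x τ u).status = Status.active
  · have ha := active_of_step_active G x h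
    unfold weight NodeState.desire
    rw [if_pos h, if_pos ha]
    have hl : (x u).level ≤ (step G x τ u).level + 1 := by
      rw [level_of_step_active G x h]
      have := hx u
      split_ifs <;> omega
    have := pow_le_pow_of_le_one (by norm_num : (0 : ℝ) ≤ 1 / 2) (by norm_num) hl
    rw [pow_succ] at this
    linarith
  · unfold weight at h0 ⊢
    rw [if_neg h]
    linarith

theorem weight_step_le_half {τ : V → Toss R I} {u : V} (hh : LikelyHigh G x τ u) :
    weight (step G x τ) u ≤ weight x u / 2 := by
  have h0 := weight_nonneg x u
  by_cases h : (step G x τ u).status = Status.active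
  · have ha := active_of_step_active G x h
    unfold weight NodeState.desire
    rw [if_pos h, if_pos ha, level_of_step_active G x h, if_pos hh, pow_succ]
    linarith
  · unfold weight at h0 ⊢
    rw [if_neg h]
    linarith

variable [Fintype V] [DecidableRel G.Adj]

theorem effDeg_nonneg (u : V) : 0 ≤ effDeg G x u := sum_nonneg fun w _ => weight_nonneg x w

theorem effDeg_step_le_two_mul (hx : ∀ u, 1 ≤ (x u).level) (τ : V → Toss R I) (u : V) :
    effDeg G (step G x τ) u ≤ 2 * effDeg G x u := by
  unfold effDeg
  rw [mul_sum]
  exact sum_le_sum fun w _ => weight_step_le_two_mul G x hx τ w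

/-- The part of the effective degree of `v` that comes from neighbours which themselves have a
small effective degree. These neighbours may raise their desire-levels, but they are also likely to
join the independent set once they get marked. -/
def lowDeg (v : V) : ℝ := ∑ u ∈ G.neighborFinset v with effDeg G x u < 1 / 2, weight x u

theorem lowDeg_le_effDeg (v : V) : lowDeg G x v ≤ effDeg G x v :=
  sum_le_sum_of_subset_of_nonneg (filter_subset _ _) fun w _ _ => weight_nonneg x w

theorem lowDeg_nonneg (v : V) : 0 ≤ lowDeg G x v := sum_nonneg fun w _ => weight_nonneg x w

variable [DecidableEq V] [Nonempty (HalfSet I)]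

omit [DecidableRel G.Adj] in
theorem expect_weight_step_le (hx : ∀ u, 1 ≤ (x u).level) (u : V)
    (T : (V → Toss R I) → V → Toss R I) :
    𝔼 τ : V → Toss R I, weight (step G x (T τ)) u ≤
      weight x u * (1 / 2 + 3 / 2 * Pr {τ : V → Toss R I | ¬ LikelyHigh G x (T τ) u}) := by
  have h : ∀ τ : V → Toss R I, weight (step G x (T τ)) u ≤
      weight x u / 2 + 3 / 2 * weight x u * (if ¬ LikelyHigh G x (T τ) u then 1 else 0) := by
    intro τ
    split_ifs with hh
    · linarith [weight_step_le_half G x hh]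
    · linarith [weight_step_le_two_mul G x hx (T τ) u]
  refine (expect_le_expect fun τ _ => h τ).trans ?_
  rw [expect_add_distrib, Fintype.expect_const, ← mul_expect, ← pr_eq_expect]
  linarith

theorem expect_weight_step_le_of_high (hI : 14000 ≤ I) (hx : ∀ u, 1 ≤ (x u).level)
    (hR : ∀ u, (x u).level ≤ R) {u : V} {T : (V → Toss R I) → V → Toss R I}
    (hT : ∀ τ, LikelyHigh G x (T τ) u ↔ LikelyHigh G x τ u) (hd : 1 / 2 ≤ effDeg G x u) :
    𝔼 τ : V → Toss R I, weight (step G x (T τ)) u ≤ 1003 / 2000 * weight x u := by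
  have h1 := expect_weight_step_le G x hx u T
  have h2 := pr_not_likelyHigh_le G x hI hx hR u hd
  have h3 := weight_nonneg x u
  simp only [hT] at h1
  nlinarith

/-- Except for the contribution of the neighbours of small effective degree, the effective degree
nearly halves in expectation. -/
theorem expect_effDeg_step_le (hI : 14000 ≤ I) (hx : ∀ u, 1 ≤ (x u).level)
    (hR : ∀ u, (x u).level ≤ R) {v : V} {T : (V → Toss R I) → V → Toss R I}
    (hT : FixesNear G v T) :
    𝔼 τ : V → Toss R I, effDeg G (step G x (T τ)) v ≤
      1003 / 2000 * effDeg G x v + 3 / 2 * lowDeg G x v := by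
  unfold effDeg
  rw [expect_sum_comm, mul_sum]
  unfold lowDeg
  rw [mul_sum, sum_filter, ← sum_add_distrib]
  refine sum_le_sum fun u hu => ?_
  have h0 := weight_nonneg x u
  split_ifs with h
  · refine (expect_le_expect fun τ _ => weight_step_le_two_mul G x hx (T τ) u).trans ?_
    rw [Fintype.expect_const]
    linarith
  · linarith [expect_weight_step_le_of_high G x hI hx hR
      (fun τ => hT.likelyHigh_adj_iff x τ (by simpa using hu)) (not_lt.1 h)]

theorem pr_step_active_le (hx : ∀ u, 1 ≤ (x u).level) (hR : ∀ u, (x u).level ≤ R) {v : V}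
    {T : (V → Toss R I) → V → Toss R I} (hT : FixesNear G v T) :
    Pr {τ : V → Toss R I | (step G x (T τ) v).status = Status.active} ≤
      1 - weight x v * (1 - effDeg G x v) := by
  simp only [hT.step_eq x]
  let Q : V → Toss R I → Prop := fun w τ =>
    (x w).status = Status.active ∧ heads τ.mark (x w).level
  have hQ : ∀ w, Pr {τ | Q w τ} = weight x w := pr_active_and_mark x hR
  have h1 := pr_and_forall_not Q (u := v) (S := G.neighborFinset v) (by simp)
  simp only [hQ] at h1
  have h2 : 1 - effDeg G x v ≤ ∏ w ∈ G.neighborFinset v, (1 - weight x w) :=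
    one_sub_sum_le_prod _ _ (fun w _ => weight_nonneg x w)
      fun w _ => (weight_le_half x hx w).trans (by norm_num)
  have h3 := mul_le_mul_of_nonneg_left h2 (weight_nonneg x v)
  rw [← h1] at h3
  have h4 := pr_not fun τ : V → Toss R I => Q v (τ v) ∧ ∀ w ∈ G.neighborFinset v, ¬ Q w (τ w)
  have h5 : Pr {τ : V → Toss R I | (step G x τ v).status = Status.active} ≤
      Pr {τ : V → Toss R I | ¬ (Q v (τ v) ∧ ∀ w ∈ G.neighborFinset v, ¬ Q w (τ w))} := by
    refine pr_mono fun τ h hq => ?_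
    have : Joins G x τ v := joins_of_isolated G x hq.1 fun w hw => hq.2 w (by simpa using hw)
    rw [step_of_joins G x this] at h
    cases h
  linarith

/-- A node is removed with constant probability when its neighbours of small effective degree have
a non-negligible total desire-level. -/
theorem pr_step_active_le_of_lowDeg (hx : ∀ u, 1 ≤ (x u).level) (hR : ∀ u, (x u).level ≤ R) {v : V}
    {T : (V → Toss R I) → V → Toss R I} (hT : FixesNear G v T) (hd : 1 / 100 ≤ lowDeg G x v) :
    Pr {τ : V → Toss R I | (step G x (T τ) v).status = Status.active} ≤ 201 / 202 := by
  simp only [hT.step_eq x]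
  let Q : V → Toss R I → Prop := fun w τ =>
    (x w).status = Status.active ∧ heads τ.mark (x w).level
  have hQ : ∀ w, Pr {τ | Q w τ} = weight x w := pr_active_and_mark x hR
  let L : Finset V := {u ∈ G.neighborFinset v | effDeg G x u < 1 / 2}
  have h1 := le_pr_exists_isolated Q (fun u => G.neighborFinset u) (fun u => by simp) (1 / 2)
    L (by
      intro u hu
      simp only [hQ]
      refine le_trans ?_ (one_sub_sum_le_prod _ _ (fun w _ => weight_nonneg x w)
        fun w _ => (weight_le_half x hx w).trans (by norm_num))
      change 1 / 2 ≤ 1 - effDeg G x u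
      linarith [(mem_filter.1 hu).2])
  simp only [hQ] at h1
  have h2 : ∏ w ∈ L, (1 - weight x w) ≤ 100 / 101 := by
    refine (prod_one_sub_le _ _ (fun w _ => weight_nonneg x w)
      fun w _ => (weight_le_half x hx w).trans (by norm_num)).trans ?_
    change 1 / (1 + lowDeg G x v) ≤ _
    rw [div_le_div_iff₀ (by linarith) (by norm_num)]
    linarith
  have h4 := pr_not fun τ : V → Toss R I => ∃ u ∈ L, Q u (τ u) ∧ ∀ w ∈ G.neighborFinset u, ¬ Q w (τ w)
  have h5 : Pr {τ : V → Toss R I | (step G x τ v).status = Status.active} ≤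
      Pr {τ : V → Toss R I | ¬ ∃ u ∈ L, Q u (τ u) ∧ ∀ w ∈ G.neighborFinset u, ¬ Q w (τ w)} := by
    refine pr_mono fun τ h hq => ?_
    obtain ⟨u, hu, hq1, hq2⟩ := hq
    have hvu : G.Adj v u := by simpa using (mem_filter.1 hu).1
    have hu : Joins G x τ u := joins_of_isolated G x hq1 fun w hw => hq2 w (by simpa using hw)
    have ha := active_of_step_active G x h
    by_cases hv : Joins G x τ v
    · rw [step_of_joins G x hv] at h
      cases h
    · rw [step_of_adj_joins G x ha hv hvu hu] at h
      cases h
  linarith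

/-- Two neighbours can join in the same round only if they select the same half of the slots: this
has probability `1 / binom(I, I/2)` even when all other coin tosses are fixed. -/
theorem pr_joins_and_adj_joins_le (hR : ∀ u, (x u).level ≤ R) (v : V) :
    Pr {τ : V → Toss R I | Joins G x τ v ∧ ∃ u, G.Adj v u ∧ Joins G x τ u} ≤
      weight x v / Nat.card (HalfSet I) := by
  rw [pr_eq_expect, expect_update v]
  refine expect_le univ_nonempty fun σ _ => ?_
  rw [← pr_eq_expect]
  have hw : 0 ≤ weight x v / Nat.card (HalfSet I) := div_nonneg (weight_nonneg x v) (by positivity)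
  by_cases h : ∃ u, G.Adj v u ∧ Marked x σ u
  · obtain ⟨u, huv, hu⟩ := h
    refine le_trans (pr_mono fun τ hτ => ?_) (pr_mark_and_slots_eq_le x hR v (σ u).slots)
    obtain ⟨⟨hm, hj⟩, -⟩ := hτ
    have hne : u ≠ v := huv.ne'
    have hm' : (x v).status = Status.active ∧ heads τ.mark (x v).level := by
      simpa [Marked] using hm
    refine ⟨hm', ?_⟩
    have hsub : (σ u).slots ⊆ τ.slots := by
      intro i hi
      by_contra hc
      refine hj i ⟨fun hb => hc (by simpa using hb.2), u, huv, ?_⟩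
      simpa [beepsSecond, Marked, hne, hi] using hu
    refine (eq_of_subset_of_card_le hsub ?_).symm
    have h1 := τ.2.2.2.2
    have h2 := (σ u).2.2.2.2
    unfold Toss.slots
    omega
  · refine le_trans (le_of_eq ?_) hw
    have : ∀ τ : Toss R I, ¬ (Joins G x (Function.update σ v τ) v ∧
        ∃ u, G.Adj v u ∧ Joins G x (Function.update σ v τ) u) := by
      rintro τ ⟨-, u, huv, ⟨hm, -⟩⟩
      refine h ⟨u, huv, ?_⟩
      simpa [Marked, huv.ne'] using hm
    simp [this, Pr]

end Step

/-! ### Two potential functions -/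

section Potential

/-- An upper bound for the expected sum of the desire-levels of `v` over the remaining rounds in which
it is active. -/
def budget {V : Type*} (x : V → NodeState) (v : V) : ℝ := if (x v).status = Status.active then 3 * weight x v + 8 else 0

theorem budget_nonneg {V : Type*} (x : V → NodeState) (v : V) : 0 ≤ budget x v := by
  have := weight_nonneg x v
  unfold budget
  split_ifs <;> linarith

variable {V : Type*} {R I : ℕ} [Fintype V] (G : SimpleGraph V) [DecidableRel G.Adj]
  (x : V → NodeState)

/-- A measure of how far the node `v` is from being removed; `0` once it has terminated. It is small
if the desire-level of `v` is large and the effective degree of `v` is small. The constant `2/25`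
keeps it positive for isolated nodes, and the base `6/5` of the dependence on the level is so small
that the decrease of a large effective degree outweighs the decrease of the desire-level. -/
def energy (v : V) : ℝ :=
  if (x v).status = Status.active then (6 / 5) ^ (x v).level * (effDeg G x v + 2 / 25) else 0

theorem energy_nonneg (v : V) : 0 ≤ energy G x v := by
  have := effDeg_nonneg G x v
  unfold energy
  split_ifs <;> positivity

theorem energy_step_le (hx : ∀ u, 1 ≤ (x u).level) {v : V} (τ : V → Toss R I) :
    energy G (step G x τ) v ≤ (6 / 5) ^ ((x v).level + 1) * (effDeg G (step G x τ) v + 2 / 25) := by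
  have h0 := effDeg_nonneg G (step G x τ) v
  unfold energy
  split_ifs with h
  · refine mul_le_mul_of_nonneg_right (pow_le_pow_right₀ (by norm_num) ?_) (by positivity)
    rw [level_of_step_active G x h]
    have := hx v
    split_ifs <;> omega
  · positivity

theorem energy_step_le_mul (hx : ∀ u, 1 ≤ (x u).level) {v : V}
    (hv : (x v).status = Status.active) (τ : V → Toss R I) :
    energy G (step G x τ) v ≤ 12 / 5 * energy G x v := by
  refine (energy_step_le G x hx τ).trans ?_
  have h1 := effDeg_step_le_two_mul G x hx τ v
  unfold energy
  rw [if_pos hv, pow_succ]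
  have : (0 : ℝ) < (6 / 5) ^ (x v).level := by positivity
  nlinarith

/-- The energy after the round, split according to the estimate of `v`. -/
theorem energy_step_le_add (hx : ∀ u, 1 ≤ (x u).level) {v : V} (τ : V → Toss R I) :
    energy G (step G x τ) v ≤
      (6 / 5) ^ (max ((x v).level - 1) 1) * (effDeg G (step G x τ) v +
        2 / 25 * if (step G x τ v).status = Status.active then 1 else 0) +
      (6 / 5) ^ ((x v).level + 1) * (2 * effDeg G x v + 2 / 25) *
        if LikelyHigh G x τ v then 1 else 0 := by
  have h0 := effDeg_nonneg G (step G x τ) v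
  have h1 := effDeg_nonneg G x v
  by_cases h : (step G x τ v).status = Status.active
  · by_cases hh : LikelyHigh G x τ v
    · rw [if_pos hh, mul_one]
      refine (energy_step_le G x hx τ).trans ?_
      refine le_add_of_nonneg_of_le (by rw [if_pos h]; positivity) ?_
      refine mul_le_mul_of_nonneg_left ?_ (by positivity)
      linarith [effDeg_step_le_two_mul G x hx τ v]
    · unfold energy
      rw [if_pos h, level_of_step_active G x h, if_neg hh, if_neg hh, if_pos h]
      simp
  · unfold energy
    rw [if_neg h]
    split_ifs <;> positivity

variable [DecidableEq V] [Nonempty (HalfSet I)] {v : V} {T : (V → Toss R I) → V → Toss R I}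

theorem expect_energy_step_le_add (hI : 14000 ≤ I) (hx : ∀ u, 1 ≤ (x u).level)
    (hR : ∀ u, (x u).level ≤ R) (hT : FixesNear G v T) (hd : effDeg G x v ≤ 1 / 8) :
    𝔼 τ : V → Toss R I, energy G (step G x (T τ)) v ≤
      (6 / 5) ^ (max ((x v).level - 1) 1) *
        (1003 / 2000 * effDeg G x v + 3 / 2 * lowDeg G x v +
          2 / 25 * Pr {τ : V → Toss R I | (step G x (T τ) v).status = Status.active}) +
      (6 / 5) ^ ((x v).level + 1) * (2 * effDeg G x v + 2 / 25) * (1 / 1000) := by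
  refine (expect_le_expect fun τ _ => energy_step_le_add G x hx (T τ)).trans ?_
  rw [expect_add_distrib, ← mul_expect, ← mul_expect, expect_add_distrib, ← mul_expect,
    ← pr_eq_expect, ← pr_eq_expect]
  have h0 := effDeg_nonneg G x v
  refine add_le_add (mul_le_mul_of_nonneg_left ?_ (by positivity))
    (mul_le_mul_of_nonneg_left ?_ (by positivity))
  · linarith [expect_effDeg_step_le G x hI hx hR hT]
  · simp only [hT.likelyHigh_iff x]
    exact pr_likelyHigh_le G x hI hx hR v hd

/-- Unless the neighbours of small effective degree contribute much, the energy decreases by a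
constant factor in expectation. -/
theorem expect_energy_step_le (hI : 14000 ≤ I) (hx : ∀ u, 1 ≤ (x u).level)
    (hR : ∀ u, (x u).level ≤ R) (hT : FixesNear G v T) (hv : (x v).status = Status.active)
    (hl : lowDeg G x v < 1 / 100) :
    𝔼 τ : V → Toss R I, energy G (step G x (T τ)) v ≤ 19 / 20 * energy G x v := by
  have h0 := effDeg_nonneg G x v
  have hl0 := lowDeg_nonneg G x v
  have hl1 := lowDeg_le_effDeg G x v
  have hP : (0 : ℝ) < (6 / 5) ^ (x v).level := by positivity
  have he : energy G x v = (6 / 5) ^ (x v).level * (effDeg G x v + 2 / 25) := if_pos hv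
  have hone := hx v
  rw [he, mul_left_comm]
  rcases lt_or_ge (1 / 8) (effDeg G x v) with hd | hd
  · refine (expect_le_expect fun τ _ => energy_step_le G x hx (T τ)).trans ?_
    rw [← mul_expect, expect_add_distrib, Fintype.expect_const, pow_succ, mul_assoc]
    refine mul_le_mul_of_nonneg_left ?_ hP.le
    linarith [expect_effDeg_step_le G x hI hx hR hT]
  · have hmain := expect_energy_step_le_add G x hI hx hR hT hd
    have hact := pr_step_active_le G x hx hR hT
    refine hmain.trans ?_
    rcases eq_or_lt_of_le hone with hk | hk
    · -- at desire-level `1/2` the energy decreases because `v` is likely to join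
      have hw : weight x v = 1 / 2 := by
        unfold weight NodeState.desire; rw [if_pos hv, ← hk]; norm_num
      rw [hw] at hact
      rw [← hk]
      norm_num
      linarith
    · have hk1 : max ((x v).level - 1) 1 = (x v).level - 1 := by omega
      have hk2 : (6 / 5 : ℝ) ^ ((x v).level - 1) = 5 / 6 * (6 / 5) ^ (x v).level := by
        obtain ⟨k, hk⟩ : ∃ k, (x v).level = k + 1 := ⟨(x v).level - 1, by omega⟩
        rw [hk, Nat.add_sub_cancel, pow_succ]; ring
      have hone : Pr {τ : V → Toss R I | (step G x (T τ) v).status = Status.active} ≤ 1 := pr_le_one _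
      rw [hk1, hk2, pow_succ]
      have : 5 / 6 * (1003 / 2000 * effDeg G x v + 3 / 2 * lowDeg G x v +
          2 / 25 * Pr {τ : V → Toss R I | (step G x (T τ) v).status = Status.active}) +
          6 / 5 * (2 * effDeg G x v + 2 / 25) * (1 / 1000) ≤ 19 / 20 * (effDeg G x v + 2 / 25) := by
        linarith
      have := mul_le_mul_of_nonneg_left this hP.le
      linarith

theorem rpow_le_rpow_mul_linear {a b η : ℝ} (ha : 0 < a) (hb : 0 ≤ b) (h0 : 0 ≤ η) (h1 : η ≤ 1) :
    b ^ η ≤ a ^ η * (1 - η + η * (b / a)) := by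
  have hba : 0 ≤ b / a := by positivity
  have h := rpow_one_add_le_one_add_mul_self (s := b / a - 1) (by linarith) h0 h1
  rw [add_sub_cancel] at h
  calc b ^ η = a ^ η * (b / a) ^ η := by
        rw [← Real.mul_rpow ha.le hba, mul_div_cancel₀ _ ha.ne']
    _ ≤ _ := by
        refine mul_le_mul_of_nonneg_left ?_ (by positivity)
        linarith

/-- A small power of the energy decreases by a constant factor in expectation, whatever the state
is. In a round in which the energy may grow, `v` is removed with constant probability; a small
power of the energy grows so little that this outweighs it. -/
theorem expect_rpow_energy_step_le (hI : 14000 ≤ I) (hx : ∀ u, 1 ≤ (x u).level)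
    (hR : ∀ u, (x u).level ≤ R) (hT : FixesNear G v T) :
    𝔼 τ : V → Toss R I, energy G (step G x (T τ)) v ^ (1 / 1000 : ℝ) ≤
      (1 - 1 / 20000) * energy G x v ^ (1 / 1000 : ℝ) := by
  by_cases hv : (x v).status = Status.active
  · have hpos : 0 < energy G x v := by
      have := effDeg_nonneg G x v
      unfold energy; rw [if_pos hv]; positivity
    have hE : 0 < energy G x v ^ (1 / 1000 : ℝ) := by positivity
    have hpt : ∀ τ : V → Toss R I, energy G (step G x (T τ)) v ^ (1 / 1000 : ℝ) ≤
        energy G x v ^ (1 / 1000 : ℝ) *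
          (999 / 1000 * (if (step G x (T τ) v).status = Status.active then 1 else 0) +
            1 / 1000 * (energy G (step G x (T τ)) v / energy G x v)) := by
      intro τ
      by_cases h : (step G x (T τ) v).status = Status.active
      · rw [if_pos h]
        refine (rpow_le_rpow_mul_linear hpos (energy_nonneg G _ v) (by norm_num)
          (by norm_num : (1 / 1000 : ℝ) ≤ 1)).trans (le_of_eq ?_)
        ring
      · have : energy G (step G x (T τ)) v = 0 := if_neg h
        rw [if_neg h, this, Real.zero_rpow (by norm_num)]
        simp
    by_cases hl : lowDeg G x v < 1 / 100
    · refine (expect_le_expect fun τ _ => hpt τ).trans ?_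
      rw [← mul_expect, expect_add_distrib, ← mul_expect, ← mul_expect, ← expect_div,
        ← pr_eq_expect, mul_comm]
      refine mul_le_mul_of_nonneg_right ?_ hE.le
      have h1 := expect_energy_step_le G x hI hx hR hT hv hl
      have h2 : Pr {τ : V → Toss R I | (step G x (T τ) v).status = Status.active} ≤ 1 := pr_le_one _
      rw [← div_le_iff₀ hpos] at h1
      linarith
    · have hpt' : ∀ τ : V → Toss R I, energy G (step G x (T τ)) v ^ (1 / 1000 : ℝ) ≤
          energy G x v ^ (1 / 1000 : ℝ) *
            (10014 / 10000 * (if (step G x (T τ) v).status = Status.active then 1 else 0)) := by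
        intro τ
        refine (hpt τ).trans (mul_le_mul_of_nonneg_left ?_ hE.le)
        split_ifs with h
        · have := energy_step_le_mul G x hx hv (T τ)
          rw [← div_le_iff₀ hpos] at this
          linarith
        · have : energy G (step G x (T τ)) v = 0 := if_neg h
          rw [this]; simp
      refine (expect_le_expect fun τ _ => hpt' τ).trans ?_
      rw [← mul_expect, ← mul_expect, ← pr_eq_expect, mul_comm]
      refine mul_le_mul_of_nonneg_right ?_ hE.le
      have := pr_step_active_le_of_lowDeg G x hx hR hT (not_lt.1 hl)
      linarith
  · have h1 : energy G x v = 0 := if_neg hv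
    have h2 : ∀ τ : V → Toss R I, energy G (step G x (T τ)) v = 0 := fun τ =>
      if_neg fun h => hv (active_of_step_active G x h)
    simp only [h1, h2]
    rw [Real.zero_rpow (by norm_num)]
    simp

/-- Either the effective degree is small, and `v` joins with probability proportional to its
desire-level, or it is large, and the desire-level is likely to be halved. -/
theorem expect_budget_step_le (hI : 14000 ≤ I) (hx : ∀ u, 1 ≤ (x u).level)
    (hR : ∀ u, (x u).level ≤ R) (hT : FixesNear G v T) :
    𝔼 τ : V → Toss R I, budget (step G x (T τ)) v ≤ budget x v - weight x v := by
  by_cases hv : (x v).status = Status.active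
  · have h0 := weight_nonneg x v
    have hb : budget x v = 3 * weight x v + 8 := if_pos hv
    rw [hb]
    rcases le_or_gt (1 / 2) (effDeg G x v) with hd | hd
    · have hpt : ∀ τ : V → Toss R I, budget (step G x (T τ)) v ≤ 3 * weight (step G x (T τ)) v + 8 := by
        intro τ
        have := weight_nonneg (step G x (T τ)) v
        unfold budget
        split_ifs <;> linarith
      refine (expect_le_expect fun τ _ => hpt τ).trans ?_
      rw [expect_add_distrib, Fintype.expect_const, ← mul_expect]
      linarith [expect_weight_step_le_of_high G x hI hx hR (hT.likelyHigh_iff x) hd]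
    · have hpt : ∀ τ : V → Toss R I, budget (step G x (T τ)) v ≤ 6 * weight x v +
          8 * (if (step G x (T τ) v).status = Status.active then 1 else 0) := by
        intro τ
        have := weight_step_le_two_mul G x hx (T τ) v
        unfold budget
        split_ifs <;> linarith
      refine (expect_le_expect fun τ _ => hpt τ).trans ?_
      rw [expect_add_distrib, Fintype.expect_const, ← mul_expect, ← pr_eq_expect]
      have := pr_step_active_le G x hx hR hT
      nlinarith
  · have h1 : budget x v = 0 := if_neg hv
    have h2 : weight x v = 0 := if_neg hv
    have h3 : ∀ τ : V → Toss R I, budget (step G x (T τ)) v = 0 := fun τ =>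
      if_neg fun h => hv (active_of_step_active G x h)
    simp [h1, h2, h3]

end Potential

/-! ### Local correctness of the output -/

section Correctness

variable {V : Type*} {R I : ℕ} (G : SimpleGraph V) (ω : Tosses V R I)

theorem run_succ {t : ℕ} (h : t < R) : run G ω (t + 1) = step G (run G ω t) (ω ⟨t, h⟩) := by
  rw [run, dif_pos h]

theorem run_succ_of_le {t : ℕ} (h : R ≤ t) : run G ω (t + 1) = run G ω t := by
  rw [run, dif_neg (not_lt.2 h)]

theorem run_eq_of_not_active {t t' : ℕ} {u : V} (h : (run G ω t u).status ≠ Status.active)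
    (ht : t ≤ t') : run G ω t' u = run G ω t u := by
  induction t', ht using Nat.le_induction with
  | base => rfl
  | succ n hn ih =>
    rcases lt_or_ge n R with hR | hR
    · rw [run_succ G ω hR, step_of_not_active, ih]
      rwa [ih]
    · rw [run_succ_of_le G ω hR, ih]

/-- As soon as a node outputs IN, its neighbours terminate. -/
theorem not_active_of_adj_isIn {u v : V} (huv : G.Adj v u) (t : ℕ)
    (hu : (run G ω t u).status = Status.isIn) : (run G ω t v).status ≠ Status.active := by
  induction t with
  | zero => simp [run, initial] at hu
  | succ t ih =>
    rcases lt_or_ge t R with hR | hR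
    · rw [run_succ G ω hR] at hu ⊢
      intro hv
      have hav := active_of_step_active G _ hv
      by_cases hau : (run G ω t u).status = Status.active
      · have hju : Joins G (run G ω t) (ω ⟨t, hR⟩) u := by
          by_contra hju
          unfold step at hu
          rw [if_pos hau, if_neg hju] at hu
          split_ifs at hu
        by_cases hjv : Joins G (run G ω t) (ω ⟨t, hR⟩) v
        · rw [step_of_joins G _ hjv] at hv
          cases hv
        · rw [step_of_adj_joins G _ hav hjv huv hju] at hv
          cases hv
      · rw [step_of_not_active G _ _ hau] at hu
        exact ih hu hav
    · rw [run_succ_of_le G ω hR] at hu ⊢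
      exact ih hu

/-- In some round `v` joins simultaneously with one of its neighbours. -/
def Clash (v : V) : Prop :=
  ∃ t : Fin R, Joins G (run G ω t) (ω t) v ∧ ∃ u, G.Adj v u ∧ Joins G (run G ω t) (ω t) u

/-- An output can only be incorrect through a clash. -/
theorem exists_terminatesCorrectlyAt {v : V} (hR : (run G ω R v).status ≠ Status.active)
    (hc : ¬ Clash G ω v) :
    ∃ s ≤ R * slotsPerRound I, TerminatesCorrectlyAt G ω v s := by
  have hex : ∃ t, (run G ω t v).status ≠ Status.active := ⟨R, hR⟩
  have hne := Nat.find_spec hex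
  have hmin : ∀ t < Nat.find hex, (run G ω t v).status = Status.active := fun t ht =>
    not_not.1 (Nat.find_min hex ht)
  have hle : Nat.find hex ≤ R := Nat.find_min' hex hR
  have h0 : Nat.find hex ≠ 0 := by
    intro h0
    rw [h0] at hne
    simp [run, initial] at hne
  obtain ⟨t, ht⟩ := Nat.exists_eq_succ_of_ne_zero h0
  rw [ht] at hne hmin hle
  have htR : t < R := hle
  have hpos : 0 < slotsPerRound I := Nat.succ_pos _
  have hdiv : (t + 1) * slotsPerRound I / slotsPerRound I = t + 1 := Nat.mul_div_cancel _ hpos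
  have hact := hmin t (Nat.lt_succ_self t)
  refine ⟨(t + 1) * slotsPerRound I, Nat.mul_le_mul_right _ hle, ?_, ?_, ?_⟩
  · intro s hs
    exact hmin _ ((Nat.div_lt_iff_lt_mul hpos).2 hs)
  · intro s hs
    have : t + 1 ≤ s / slotsPerRound I := (Nat.le_div_iff_mul_le hpos).2 hs
    unfold statusAt
    rw [hdiv, run_eq_of_not_active G ω hne this]
  · unfold statusAt
    rw [hdiv]
    have hstep := run_succ G ω htR
    by_cases hj : Joins G (run G ω t) (ω ⟨t, htR⟩) v
    · left
      refine ⟨by rw [hstep]; exact step_of_joins G _ hj, fun u hu s hs => ?_⟩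
      have hs' : t + 1 ≤ s / slotsPerRound I := (Nat.le_div_iff_mul_le hpos).2 hs
      have hju : ¬ Joins G (run G ω t) (ω ⟨t, htR⟩) u := fun hju => hc ⟨⟨t, htR⟩, hj, u, hu, hju⟩
      have hout : (run G ω (t + 1) u).status = Status.isOut := by
        by_cases hau : (run G ω t u).status = Status.active
        · rw [hstep]
          exact step_of_adj_joins G _ hau hju hu.symm hj
        · rw [run_eq_of_not_active G ω hau (Nat.le_succ t)]
          have := fun h => not_active_of_adj_isIn G ω hu t h hact
          cases hst : (run G ω t u).status with
          | active => exact absurd hst hau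
          | isIn => exact absurd hst this
          | isOut => rfl
      rw [run_eq_of_not_active G ω (by rw [hout]; simp) hs', hout]
      simp
    · right
      have hh : hears G (Joins G (run G ω t) (ω ⟨t, htR⟩)) v := by
        by_contra hh
        rw [Nat.succ_eq_add_one, hstep] at hne
        unfold step at hne
        rw [if_pos hact, if_neg hj, if_neg hh] at hne
        split_ifs at hne <;> exact hne rfl
      obtain ⟨-, u, hu, hju⟩ := hh
      refine ⟨?_, u, hu, ?_⟩
      · rw [hstep]
        exact step_of_adj_joins G _ hact hj hu hju
      · rw [hstep]
        exact step_of_joins G _ hju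

end Correctness

/-! ### Iteration over the rounds against the adversary -/

section Rounds

variable {V : Type*} {R I : ℕ} (G : SimpleGraph V)

theorem run_congr {ω ω' : Tosses V R I} (t : ℕ) (h : ∀ s : Fin R, s.val < t → ω s = ω' s) :
    run G ω t = run G ω' t := by
  induction t with
  | zero => rfl
  | succ t ih =>
    have ih' := ih fun s hs => h s (by omega)
    rcases lt_or_ge t R with hR | hR
    · rw [run_succ G ω hR, run_succ G ω' hR, ih', h ⟨t, hR⟩ (Nat.lt_succ_self t)]
    · rw [run_succ_of_le G ω hR, run_succ_of_le G ω' hR, ih']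

variable [Fintype V] [DecidableEq V] [Nonempty (HalfSet I)] {v : V} {A : Set V}
  {adv : Tosses V R I → Tosses V R I}

/-- A bound for the expected effect of a single round, valid for every state and every
manipulation of far away coin tosses, holds in round `t` of a run with an adversary: the state before
the round does not depend on the tosses of the round, so these may be resampled. -/
theorem expect_round_le (hA : ∀ u ∈ A, 2 < G.edist v u) (hadv : NonAnticipating adv)
    (F : (V → NodeState) → (V → Toss R I) → ℝ) (F' : (V → NodeState) → ℝ)
    (hF : ∀ x : V → NodeState, (∀ u, 1 ≤ (x u).level) → (∀ u, (x u).level ≤ R) →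
      ∀ T : (V → Toss R I) → V → Toss R I, FixesNear G v T → 𝔼 τ, F x (T τ) ≤ F' x)
    (t : Fin R) :
    𝔼 ω, F (run G (corrupt A adv ω) t) (corrupt A adv ω t) ≤
      𝔼 ω, F' (run G (corrupt A adv ω) t) := by
  rw [expect_update t]
  refine expect_le_expect fun ω _ => ?_
  have hrun : ∀ τ, run G (corrupt A adv (Function.update ω t τ)) t = run G (corrupt A adv ω) t := by
    intro τ
    refine run_congr G t fun s hs => ?_
    have hupd : ∀ r ≤ s, Function.update ω t τ r = ω r := fun r hr =>
      Function.update_of_ne (ne_of_lt (lt_of_le_of_lt hr (Fin.lt_def.2 hs))) _ _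
    funext u
    unfold corrupt
    rw [hadv _ ω s hupd, hupd s le_rfl]
  simp only [hrun]
  refine hF _ (fun u => (level_run G _ t u).1)
    (fun u => (level_run G _ t u).2.trans t.2)
    (fun τ => corrupt A adv (Function.update ω t τ) t) ?_
  intro τ u hu
  have : u ∉ A := fun h => not_lt.2 hu (hA u h)
  simp [corrupt, this]

variable [DecidableRel G.Adj]

theorem expect_rpow_energy_run_le (hI : 14000 ≤ I) (hA : ∀ u ∈ A, 2 < G.edist v u)
    (hadv : NonAnticipating adv) {t : ℕ} (ht : t ≤ R) :
    𝔼 ω, energy G (run G (corrupt A adv ω) t) v ^ (1 / 1000 : ℝ) ≤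
      (1 - 1 / 20000) ^ t * energy G (fun _ => initial) v ^ (1 / 1000 : ℝ) := by
  induction t with
  | zero => simp [run]
  | succ t ih =>
    have h := expect_round_le G hA hadv
      (fun x τ => energy G (step G x τ) v ^ (1 / 1000 : ℝ))
      (fun x => (1 - 1 / 20000) * energy G x v ^ (1 / 1000 : ℝ))
      (fun x hx hR T hT => expect_rpow_energy_step_le G x hI hx hR hT) ⟨t, ht⟩
    simp only [← run_succ G _ ht] at h
    refine h.trans ?_
    rw [← mul_expect, pow_succ', mul_assoc]
    exact mul_le_mul_of_nonneg_left (ih (by omega)) (by norm_num)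

theorem sum_expect_weight_run_le (hI : 14000 ≤ I) (hA : ∀ u ∈ A, 2 < G.edist v u)
    (hadv : NonAnticipating adv) :
    ∑ t : Fin R, 𝔼 ω, weight (run G (corrupt A adv ω) t) v ≤ 10 := by
  have key : ∀ t ≤ R, 𝔼 ω, budget (run G (corrupt A adv ω) t) v +
      ∑ s ∈ range t, 𝔼 ω, weight (run G (corrupt A adv ω) s) v ≤ 10 := by
    intro t
    induction t with
    | zero => intro _; norm_num [run, budget, weight, initial, NodeState.desire]
    | succ t ih =>
      intro ht
      have h := expect_round_le G hA hadv (fun x τ => budget (step G x τ) v)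
        (fun x => budget x v - weight x v)
        (fun x hx hR T hT => expect_budget_step_le G x hI hx hR hT) ⟨t, ht⟩
      simp only [← run_succ G _ ht] at h
      rw [expect_sub_distrib] at h
      rw [sum_range_succ]
      linarith [ih (by omega)]
  have h := key R le_rfl
  have h0 : 0 ≤ 𝔼 ω, budget (run G (corrupt A adv ω) R) v :=
    expect_nonneg fun ω _ => budget_nonneg _ v
  rw [Fin.sum_univ_eq_sum_range (fun t => 𝔼 ω, weight (run G (corrupt A adv ω) t) v) R]
  linarith

theorem pr_clash_le (hI : 14000 ≤ I) (hA : ∀ u ∈ A, 2 < G.edist v u)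
    (hadv : NonAnticipating adv) :
    Pr {ω | Clash G (corrupt A adv ω) v} ≤ 10 / Nat.card (HalfSet I) := by
  have h1 : ∀ t : Fin R, Pr {ω | Joins G (run G (corrupt A adv ω) t) (corrupt A adv ω t) v ∧
      ∃ u, G.Adj v u ∧ Joins G (run G (corrupt A adv ω) t) (corrupt A adv ω t) u} ≤
      (𝔼 ω, weight (run G (corrupt A adv ω) t) v) / Nat.card (HalfSet I) := by
    intro t
    rw [pr_eq_expect, expect_div]
    refine expect_round_le G hA hadv
      (fun x τ => if Joins G x τ v ∧ ∃ u, G.Adj v u ∧ Joins G x τ u then 1 else 0)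
      (fun x => weight x v / Nat.card (HalfSet I)) ?_ t
    intro x _ hR T hT
    rw [← pr_eq_expect]
    refine le_trans (pr_mono fun τ hτ => ?_) (pr_joins_and_adj_joins_le G x hR v)
    obtain ⟨hj, u, hu, hju⟩ := hτ
    exact ⟨(hT.joins_iff x τ).1 hj, u, hu, (hT.joins_adj_iff x τ hu).1 hju⟩
  have h2 := pr_exists_le (univ : Finset (Fin R)) fun (t : Fin R) (ω : Tosses V R I) =>
    Joins G (run G (corrupt A adv ω) t) (corrupt A adv ω t) v ∧
      ∃ u, G.Adj v u ∧ Joins G (run G (corrupt A adv ω) t) (corrupt A adv ω t) u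
  have h3 : Pr {ω | Clash G (corrupt A adv ω) v} ≤
      ∑ t : Fin R, (𝔼 ω, weight (run G (corrupt A adv ω) t) v) / Nat.card (HalfSet I) := by
    refine le_trans (pr_mono fun ω h => ?_) (h2.trans (sum_le_sum fun t _ => h1 t))
    obtain ⟨t, ht⟩ := h
    exact ⟨t, mem_univ t, ht⟩
  refine h3.trans ?_
  rw [← sum_div]
  exact div_le_div_of_nonneg_right (sum_expect_weight_run_le G hI hA hadv) (by positivity)

/-- Markov's inequality for the energy after the last round. -/
theorem pr_active_le (hI : 14000 ≤ I) (hA : ∀ u ∈ A, 2 < G.edist v u)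
    (hadv : NonAnticipating adv) :
    Pr {ω | (run G (corrupt A adv ω) R v).status = Status.active} ≤
      (1 - 1 / 20000) ^ R * (1 + 25 / 4 * G.maxDegree) ^ (1 / 1000 : ℝ) := by
  have hmain := expect_rpow_energy_run_le G hI hA hadv le_rfl
  -- `12/125 = 6/5 * 2/25` is the least energy of an active node
  have hc : (0 : ℝ) < (12 / 125) ^ (1 / 1000 : ℝ) := by positivity
  have h1 : Pr {ω | (run G (corrupt A adv ω) R v).status = Status.active} *
      (12 / 125) ^ (1 / 1000 : ℝ) ≤
      𝔼 ω, energy G (run G (corrupt A adv ω) R) v ^ (1 / 1000 : ℝ) := by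
    rw [pr_eq_expect, expect_mul]
    refine expect_le_expect fun ω _ => ?_
    have h0 := energy_nonneg G (run G (corrupt A adv ω) R) v
    split_ifs with h
    · rw [one_mul]
      refine Real.rpow_le_rpow (by norm_num) ?_ (by norm_num)
      have hd := effDeg_nonneg G (run G (corrupt A adv ω) R) v
      have hl := (level_run G (corrupt A adv ω) R v).1
      unfold energy
      rw [if_pos h]
      have hp : (6 / 5 : ℝ) ^ 1 ≤ (6 / 5) ^ (run G (corrupt A adv ω) R v).level :=
        pow_le_pow_right₀ (by norm_num) hl
      nlinarith
    · rw [zero_mul]; positivity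
  have h2 : energy G (fun _ => initial) v ≤ 12 / 125 * (1 + 25 / 4 * G.maxDegree) := by
    have hd : effDeg G (fun _ => initial) v = (G.degree v : ℝ) * (1 / 2) := by
      simp [effDeg, weight, initial, NodeState.desire]
    have hdeg : (G.degree v : ℝ) ≤ G.maxDegree := by exact_mod_cast G.degree_le_maxDegree v
    have he : energy G (fun _ => initial) v =
        (6 / 5) ^ 1 * (effDeg G (fun _ => initial) v + 2 / 25) := if_pos rfl
    rw [he, hd]
    linarith
  have h3 : energy G (fun _ => initial) v ^ (1 / 1000 : ℝ) ≤
      (12 / 125) ^ (1 / 1000 : ℝ) * (1 + 25 / 4 * G.maxDegree) ^ (1 / 1000 : ℝ) := by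
    rw [← Real.mul_rpow (by norm_num) (by positivity)]
    exact Real.rpow_le_rpow (energy_nonneg G _ v) h2 (by norm_num)
  have h4 : (0 : ℝ) ≤ (1 - 1 / 20000) ^ R := by positivity
  have h5 := mul_le_mul_of_nonneg_left h3 h4
  refine le_of_mul_le_mul_right ?_ hc
  linarith

theorem one_sub_le_pr_terminatesCorrectlyAt (hI : 14000 ≤ I) (hA : ∀ u ∈ A, 2 < G.edist v u)
    (hadv : NonAnticipating adv) :
    1 - ((1 - 1 / 20000) ^ R * (1 + 25 / 4 * G.maxDegree) ^ (1 / 1000 : ℝ) +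
        10 / Nat.card (HalfSet I)) ≤
      Pr {ω : Tosses V R I | ∃ s ≤ R * slotsPerRound I,
        TerminatesCorrectlyAt G (corrupt A adv ω) v s} := by
  have h1 : Pr {ω : Tosses V R I | ¬ ∃ s ≤ R * slotsPerRound I,
      TerminatesCorrectlyAt G (corrupt A adv ω) v s} ≤
      Pr {ω | (run G (corrupt A adv ω) R v).status = Status.active ∨
        Clash G (corrupt A adv ω) v} := by
    refine pr_mono fun ω h => ?_
    by_contra hc
    rw [not_or] at hc
    exact h (exists_terminatesCorrectlyAt G _ hc.1 hc.2)
  have h2 := pr_or_le (fun ω => (run G (corrupt A adv ω) R v).status = Status.active)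
    fun ω : Tosses V R I => Clash G (corrupt A adv ω) v
  rw [pr_not] at h1
  linarith [pr_active_le G hI hA hadv, pr_clash_le G hI hA hadv]

end Rounds

/-! ### The parameters of the algorithm -/

section Parameters

theorem half_le_log_two : 1 / 2 ≤ Real.log 2 := by
  linarith [Real.log_two_gt_d9]

theorem half_le_log_two_div {ε : ℝ} (h0 : 0 < ε) (h1 : ε < 1) : 1 / 2 ≤ Real.log (2 / ε) := by
  refine half_le_log_two.trans (Real.log_le_log (by norm_num) ?_)
  rw [le_div_iff₀ h0]
  linarith

theorem le_halfLen (ε : ℝ) : 1000 * (Real.log 1500 + Real.log (2 / ε)) ≤ halfLen ε := Nat.le_ceil _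

theorem le_intervalLen {ε : ℝ} (h0 : 0 < ε) (h1 : ε < 1) : 14000 ≤ intervalLen ε := by
  have h2 := le_halfLen ε
  have h3 := half_le_log_two_div h0 h1
  have h4 : 7 ≤ Real.log 1500 := by
    rw [Real.le_log_iff_exp_le (by norm_num)]
    calc Real.exp 7 = Real.exp 1 ^ 7 := by rw [← Real.exp_nat_mul]; norm_num
      _ ≤ 2.7182818286 ^ 7 := pow_le_pow_left₀ (Real.exp_pos 1).le Real.exp_one_lt_d9.le 7
      _ ≤ 1500 := by norm_num
  have h5 : (7000 : ℝ) ≤ halfLen ε := by linarith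
  have h6 : 7000 ≤ halfLen ε := by exact_mod_cast h5
  unfold intervalLen
  omega

theorem two_pow_le_centralBinom {n : ℕ} (hn : 0 < n) : 2 ^ n ≤ Nat.centralBinom n := by
  have h1 := Nat.four_pow_le_two_mul_self_mul_centralBinom n hn
  have h2 : 2 * n ≤ 2 ^ n := by
    obtain ⟨m, rfl⟩ := Nat.exists_eq_succ_of_ne_zero hn.ne'
    have := Nat.lt_two_pow_self (n := m)
    rw [pow_succ]
    omega
  have h3 : (4 : ℕ) ^ n = 2 ^ n * 2 ^ n := by rw [← mul_pow]; norm_num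
  rw [h3] at h1
  exact Nat.le_of_mul_le_mul_left (h1.trans (Nat.mul_le_mul_right _ h2)) (by positivity)

theorem card_halfSet (n : ℕ) : Nat.card (HalfSet (2 * n)) = Nat.centralBinom n := by
  have e : HalfSet (2 * n) ≃ {S : Finset (Fin (2 * n)) // S.card = n} :=
    Equiv.subtypeEquivRight fun S => by omega
  rw [Nat.card_congr e, Nat.card_eq_fintype_card, Fintype.card_finset_len, Fintype.card_fin,
    Nat.centralBinom]

/-- The number of half sets exceeds `exp (I / 2000)`, which the choice of `I` makes a multiple of
`1/ε`. -/
theorem div_le_card_halfSet {ε : ℝ} (h0 : 0 < ε) (h1 : ε < 1) :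
    3000 / ε ≤ Nat.card (HalfSet (intervalLen ε)) := by
  have hpos : 0 < halfLen ε := by
    have := le_intervalLen h0 h1
    unfold intervalLen at this
    omega
  have h2 := le_halfLen ε
  unfold intervalLen
  rw [card_halfSet]
  have h3 : (2 : ℝ) ^ halfLen ε ≤ Nat.centralBinom (halfLen ε) := by
    exact_mod_cast two_pow_le_centralBinom hpos
  refine le_trans ?_ h3
  have h4 : 3000 / ε = 1500 * (2 / ε) := by ring
  rw [← Real.log_le_log_iff (by positivity) (by positivity), h4,
    Real.log_mul (by norm_num) (by positivity), Real.log_pow]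
  have h5 := half_le_log_two
  have h6 : (0 : ℝ) ≤ halfLen ε := by positivity
  nlinarith

/-- A node is hardly ever active at the end, as the energy decreases by the factor `1 - 1/20000` in
every round and is polynomial in the maximum degree at the beginning. -/
theorem pow_rounds_mul_le {ε : ℝ} (h0 : 0 < ε) (h1 : ε < 1) (Δ : ℕ) :
    (1 - 1 / 20000 : ℝ) ^ rounds Δ ε * (1 + 25 / 4 * Δ) ^ (1 / 1000 : ℝ) ≤ ε / 2 := by
  have hε := half_le_log_two_div h0 h1
  have hΔ : 0 ≤ Real.log Δ := Real.log_natCast_nonneg Δ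
  have hlog : ∀ y : ℝ, 0 ≤ Real.log y → Real.log y ≤ Real.logb 2 y := by
    intro y hy
    rw [Real.logb, le_div_iff₀ (Real.log_pos (by norm_num))]
    nlinarith [Real.log_two_lt_d9]
  have hR : 104000 * (Real.log Δ + Real.log (2 / ε)) ≤ rounds Δ ε := by
    refine le_trans ?_ (Nat.le_ceil _)
    linarith [hlog Δ hΔ, hlog (2 / ε) (by linarith)]
  have hpow : (1 - 1 / 20000 : ℝ) ^ rounds Δ ε ≤
      Real.exp (-(5 * Real.log Δ)) * Real.exp (-(5 * Real.log (2 / ε))) := by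
    calc (1 - 1 / 20000 : ℝ) ^ rounds Δ ε ≤ Real.exp (-(1 / 20000)) ^ rounds Δ ε :=
          pow_le_pow_left₀ (by norm_num)
            (by linarith [Real.add_one_le_exp (-(1 / 20000 : ℝ))]) _
      _ = Real.exp (rounds Δ ε * (-(1 / 20000))) := by rw [← Real.exp_nat_mul]
      _ ≤ _ := by
          rw [← Real.exp_add, Real.exp_le_exp]
          linarith
  have hroot : (1 + 25 / 4 * Δ : ℝ) ^ (1 / 1000 : ℝ) ≤ 1 + 25 / 4 * Δ := by
    have : (1 : ℝ) ≤ 1 + 25 / 4 * Δ := le_add_of_nonneg_right (by positivity)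
    simpa using Real.rpow_le_rpow_of_exponent_le this (by norm_num : (1 / 1000 : ℝ) ≤ 1)
  have hdeg : Real.exp (-(5 * Real.log Δ)) * (1 + 25 / 4 * Δ) ≤ 8 := by
    rcases Nat.eq_zero_or_pos Δ with rfl | hpos
    · norm_num
    · have hΔ1 : (1 : ℝ) ≤ Δ := by exact_mod_cast hpos
      have : Real.exp (-(5 * Real.log Δ)) ≤ 1 / Δ := by
        calc Real.exp (-(5 * Real.log Δ)) ≤ Real.exp (-Real.log Δ) := by
              rw [Real.exp_le_exp]; linarith
          _ = 1 / Δ := by rw [Real.exp_neg, Real.exp_log (by linarith), one_div]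
      calc Real.exp (-(5 * Real.log Δ)) * (1 + 25 / 4 * Δ) ≤ 1 / Δ * (1 + 25 / 4 * Δ) :=
            mul_le_mul_of_nonneg_right this (by positivity)
        _ ≤ 8 := by
            rw [div_mul_eq_mul_div, div_le_iff₀ (by linarith)]
            linarith
  have hexp : Real.exp (-(5 * Real.log (2 / ε))) = (ε / 2) ^ 5 := by
    have h2 : 0 < 2 / ε := by positivity
    rw [Real.exp_neg, show (5 : ℝ) = (5 : ℕ) by norm_num, Real.exp_nat_mul, Real.exp_log h2,
      ← inv_pow, inv_div]
  calc (1 - 1 / 20000 : ℝ) ^ rounds Δ ε * (1 + 25 / 4 * Δ) ^ (1 / 1000 : ℝ)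
      ≤ (Real.exp (-(5 * Real.log Δ)) * Real.exp (-(5 * Real.log (2 / ε)))) *
          (1 + 25 / 4 * Δ) := mul_le_mul hpow hroot (by positivity) (by positivity)
    _ = (Real.exp (-(5 * Real.log Δ)) * (1 + 25 / 4 * Δ)) * (ε / 2) ^ 5 := by rw [hexp]; ring
    _ ≤ 8 * (ε / 2) ^ 5 := mul_le_mul_of_nonneg_right hdeg (by positivity)
    _ = 8 * (ε / 2) ^ 4 * (ε / 2) := by ring
    _ ≤ 8 * (1 / 2) ^ 4 * (ε / 2) := by gcongr
    _ ≤ ε / 2 := by linarith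

theorem rounds_mul_slotsPerRound_le {ε : ℝ} (h0 : 0 < ε) (h1 : ε < 1) (Δ : ℕ) :
    ((rounds Δ ε * slotsPerRound (intervalLen ε) : ℕ) : ℝ) ≤
      10 ^ 13 * (Real.log Δ + Real.log (2 / ε)) * Real.log (2 / ε) := by
  have hε := half_le_log_two_div h0 h1
  have hΔ : 0 ≤ Real.log Δ := Real.log_natCast_nonneg Δ
  have hlog : ∀ y : ℝ, 0 ≤ Real.log y → Real.logb 2 y ≤ 2 * Real.log y := by
    intro y hy
    rw [Real.logb, div_le_iff₀ (Real.log_pos (by norm_num))]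
    nlinarith [half_le_log_two]
  have hΔ2 := hlog Δ hΔ
  have hε2 := hlog (2 / ε) (by linarith)
  have hb : ∀ y : ℝ, 0 ≤ Real.log y → 0 ≤ Real.logb 2 y := fun y hy =>
    div_nonneg hy (Real.log_nonneg (by norm_num))
  have hR : (rounds Δ ε : ℝ) ≤ 250000 * (Real.log Δ + Real.log (2 / ε)) := by
    have := Nat.ceil_lt_add_one (a := 104000 * (Real.logb 2 Δ + Real.logb 2 (2 / ε)))
      (by linarith [hb Δ hΔ, hb (2 / ε) (by linarith)])
    unfold rounds
    linarith
  have h1500 : Real.log 1500 ≤ 1500 - 1 := Real.log_le_sub_one_of_pos (by norm_num)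
  have h1500' : 0 ≤ Real.log 1500 := Real.log_nonneg (by norm_num)
  have hI : (slotsPerRound (intervalLen ε) : ℝ) ≤ 20000000 * Real.log (2 / ε) := by
    have := Nat.ceil_lt_add_one (a := 1000 * (Real.log 1500 + Real.log (2 / ε))) (by linarith)
    unfold slotsPerRound intervalLen halfLen
    push_cast
    linarith
  rw [Nat.cast_mul]
  calc (rounds Δ ε : ℝ) * slotsPerRound (intervalLen ε)
      ≤ (250000 * (Real.log Δ + Real.log (2 / ε))) * (20000000 * Real.log (2 / ε)) :=
        mul_le_mul hR hI (by positivity) (by linarith)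
    _ = 5 * 10 ^ 12 * ((Real.log Δ + Real.log (2 / ε)) * Real.log (2 / ε)) := by ring
    _ ≤ 10 ^ 13 * ((Real.log Δ + Real.log (2 / ε)) * Real.log (2 / ε)) := by
        refine mul_le_mul_of_nonneg_right (by norm_num) ?_
        exact mul_nonneg (by linarith) (by linarith)
    _ = _ := by ring

theorem rounds_mul_slotsPerRound_le' {ε : ℝ} (h0 : 0 < ε) (h1 : ε ≤ 1 / 2) (Δ : ℕ) :
    ((rounds Δ ε * slotsPerRound (intervalLen ε) : ℕ) : ℝ) ≤
      10 ^ 14 * (Real.log Δ + Real.log (1 / ε)) * Real.log (1 / ε) := by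
  have hΔ : 0 ≤ Real.log Δ := Real.log_natCast_nonneg Δ
  have h2 : Real.log (2 / ε) = Real.log 2 + Real.log (1 / ε) := by
    rw [← Real.log_mul (by norm_num) (by positivity)]; congr 1; ring
  have h3 : Real.log 2 ≤ Real.log (1 / ε) := by
    refine Real.log_le_log (by norm_num) ?_
    rw [le_div_iff₀ h0]
    linarith
  have h4 := half_le_log_two
  refine (rounds_mul_slotsPerRound_le h0 (by linarith) Δ).trans ?_
  have h5 : (Real.log Δ + Real.log (2 / ε)) * Real.log (2 / ε) ≤
      (2 * (Real.log Δ + Real.log (1 / ε))) * (2 * Real.log (1 / ε)) :=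
    mul_le_mul (by linarith) (by linarith) (by linarith) (by linarith)
  have h6 : 0 ≤ (Real.log Δ + Real.log (1 / ε)) * Real.log (1 / ε) :=
    mul_nonneg (by linarith) (by linarith)
  rw [mul_assoc, mul_assoc]
  linarith

end Parameters

end BeepMIS

end

theorem theorem2 :
    ∃ C : ℝ, 0 < C ∧
      ∀ (V : Type u) [Fintype V] (G : SimpleGraph V) [DecidableRel G.Adj] (ε : ℝ),
        0 < ε → ε < 1 →
        -- the number of slots
        (((BeepMIS.rounds G.maxDegree ε * BeepMIS.slotsPerRound (BeepMIS.intervalLen ε) : ℕ) : ℝ) ≤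
            C * (Real.log G.maxDegree + Real.log (2 / ε)) * Real.log (2 / ε)) ∧
        (ε ≤ 1 / 2 →
          ((BeepMIS.rounds G.maxDegree ε * BeepMIS.slotsPerRound (BeepMIS.intervalLen ε) : ℕ) : ℝ) ≤
            C * (Real.log G.maxDegree + Real.log (1 / ε)) * Real.log (1 / ε)) ∧
        -- termination within this number of slots, with a locally correct output
        ∀ (v : V) (A : Set V), (∀ u ∈ A, 2 < G.edist v u) →
          ∀ adv : BeepMIS.Tosses V (BeepMIS.rounds G.maxDegree ε) (BeepMIS.intervalLen ε) →
              BeepMIS.Tosses V (BeepMIS.rounds G.maxDegree ε) (BeepMIS.intervalLen ε),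
            BeepMIS.NonAnticipating adv →
            1 - ε ≤ BeepMIS.Pr
              {ω : BeepMIS.Tosses V (BeepMIS.rounds G.maxDegree ε) (BeepMIS.intervalLen ε) |
                ∃ s ≤ BeepMIS.rounds G.maxDegree ε * BeepMIS.slotsPerRound (BeepMIS.intervalLen ε),
                  BeepMIS.TerminatesCorrectlyAt G (BeepMIS.corrupt A adv ω) v s} := by
  refine ⟨10 ^ 14, by norm_num, ?_⟩
  intro V _ G _ ε h0 h1
  refine ⟨?_, fun h2 => BeepMIS.rounds_mul_slotsPerRound_le' h0 h2 _, ?_⟩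
  · refine (BeepMIS.rounds_mul_slotsPerRound_le h0 h1 _).trans ?_
    have hε := BeepMIS.half_le_log_two_div h0 h1
    have hΔ : 0 ≤ Real.log G.maxDegree := Real.log_natCast_nonneg _
    have : 0 ≤ (Real.log G.maxDegree + Real.log (2 / ε)) * Real.log (2 / ε) :=
      mul_nonneg (by linarith) (by linarith)
    rw [mul_assoc, mul_assoc]
    linarith
  · intro v A hA adv hadv
    classical
    have hcard := BeepMIS.div_le_card_halfSet h0 h1
    have hpos : 0 < 3000 / ε := by positivity
    have : Nonempty (BeepMIS.HalfSet (BeepMIS.intervalLen ε)) := by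
      by_contra hne
      rw [not_nonempty_iff] at hne
      rw [Nat.card_of_isEmpty, Nat.cast_zero] at hcard
      linarith
    refine le_trans ?_ (BeepMIS.one_sub_le_pr_terminatesCorrectlyAt G
      (BeepMIS.le_intervalLen h0 h1) hA hadv)
    have hactive := BeepMIS.pow_rounds_mul_le h0 h1 G.maxDegree
    have hclash : 10 / (Nat.card (BeepMIS.HalfSet (BeepMIS.intervalLen ε)) : ℝ) ≤ ε / 2 := by
      rw [div_le_iff₀ (by linarith)]
      have := mul_le_mul_of_nonneg_left hcard (by linarith : 0 ≤ ε / 2)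
      have h3 : ε / 2 * (3000 / ε) = 1500 := by field_simp; norm_num
      linarith
    linarith
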